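/- **Setting.** Let $A$ be a finite set of basic actions, $\tau,\delta\notin A$, $A_\tau=A\cup\{\tau\}$, $A_{\tau\delta}=A\cup\{\tau,\delta\}$. Let $\gamma:A_{\tau\delta}\times A_{\tau\delta}\to A_{\tau\delta}$ be commutative and associative with $\gamma(\tau,a)=\gamma(\delta,a)=\delta$ for all $a\in A_{\tau\delta}$ and $\gamma(a,b)\neq\tau$ for all $a,b\in A$. Terms of $\mathrm{ACP}_{drt}^{\tau}$ are built from countably many variables, constants $\underline{a}$ ($a\in A_{\tau\delta}$), the binary operators $+$ (choice), $\cdot$ (sequence), $\parallel$ (merge), $\lfloor\!\lfloor$ (left merge), $\mid$ (communication merge) and the unary operators $\sigma$ (delay by one time slice), $\partial_H$ (encapsulation), $\tau_I$ (abstraction) for $H,I\subseteq A$, and $\nu$ (current-time-slice time-out). **Axioms** ($a,b,c\in A_{\tau\delta}$; $H,I\subseteq A$). $x+y=y+x$; $(x+y)+z=x+(y+z)$; $x+x=x$; $(x+y)\cdot z=x\cdot z+y\cdot z$; $(x\cdot y)\cdot z=x\cdot(y\cdot z)$; $x+\underline\delta=x$; $\underline\delta\cdot x=\underline\delta$; $\sigma(x)+\sigma(y)=\sigma(x+y)$;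 $\sigma(x)\cdot y=\sigma(x\cdot y)$; $\partial_H(\underline a)=\underline a$ if $a\notin H$, $=\underline\delta$ if $a\in H$; $\tau_I(\underline a)=\underline a$ if $a\notin I$, $=\underline\tau$ if $a\in I$; $\partial_H$ and $\tau_I$ distribute over $+$ and $\cdot$ and commute with $\sigma$; $x\parallel y=(x\lfloor\!\lfloor y+y\lfloor\!\lfloor x)+x\mid y$; $\underline a\lfloor\!\lfloor x=\underline a\cdot x$; $(\underline a\cdot x)\lfloor\!\lfloor y=\underline a\cdot(x\parallel y)$; $\sigma(x)\lfloor\!\lfloor\nu(y)=\underline\delta$; $\sigma(x)\lfloor\!\lfloor(\nu(y)+\sigma(z))=\sigma(x\lfloor\!\lfloor z)$; $(x+y)\lfloor\!\lfloor z=x\lfloor\!\lfloor z+y\lfloor\!\lfloor z$; $(\underline a\cdot x)\mid\underline b=(\underline a\mid\underline b)\cdot x$; $\underline a\mid(\underline b\cdot x)=(\underline a\mid\underline b)\cdot x$; $(\underline a\cdot x)\mid(\underline b\cdot y)=(\underline a\mid\underline b)\cdot(x\parallel y)$; $\nu(x)\mid\sigma(y)=\underline\delta$; $\sigma(x)\mid\nu(y)=\underline\delta$;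 $\sigma(x)\mid\sigma(y)=\sigma(x\mid y)$; $\mid$ distributes over $+$ on both sides; $\underline a\mid\underline b=\underline c$ if $\gamma(a,b)=c$; $\nu(\underline a)=\underline a$; $\nu(x+y)=\nu(x)+\nu(y)$; $\nu(x\cdot y)=\nu(x)\cdot y$; $\nu(\sigma(x))=\underline\delta$; $\underline a\cdot\underline\tau=\underline a$; $\underline a\cdot(\underline\tau\cdot(\nu(x)+y)+\nu(x))=\underline a\cdot(\nu(x)+y)$; $\underline a\cdot(\underline\tau\cdot(\nu(x)+y)+y)=\underline a\cdot(\nu(x)+y)$; $\underline a\cdot(\sigma(\underline\tau\cdot x)+\nu(y))=\underline a\cdot(\sigma(x)+\nu(y))$. **Recursion.** A recursive specification over a signature $\Sigma$ is a (possibly infinite) family $E=\{X=t_X\mid X\in V\}$ of equations, $V$ a set of variables, each $t_X$ a $\Sigma$-term with variables in $V$. A term is guarded if no variable occurs in it, or if no abstraction operator occurs in it and every occurrence of a variable lies in $t'$ for some subterm $\underline a\cdot t'$ with $a\in A$ or $\sigma(t')$. $E$ is guarded modulo a set $\Phi$ of axioms if each $t_X$ can be rewritten to a guarded $\Sigma$-term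 by applying equations of $\Phi$ in either direction and equations $Y=t_Y$ of $E$ with $Y\neq X$ from left to right. Let $\Sigma_0,\Phi_0$ be the signature and axioms above; $\Sigma_{i+1}$ adds to $\Sigma_i$ a constant $\langle X|E\rangle$ for every recursive specification $E$ over $\Sigma_i$ guarded modulo $\Phi_i$ and every variable $X$ of $E$, and $\Phi_{i+1}$ adds to $\Phi_i$ the equations $\langle X|E\rangle=\langle t_X|E\rangle$ (RDP) and the conditional equations $E\Rightarrow X=\langle X|E\rangle$ (RSP) for these $E,X$, where $\langle t|E\rangle$ is $t$ with each variable $Y$ of $E$ replaced by $\langle Y|E\rangle$. The signature and axioms of $\mathrm{ACP}_{drt}^{\tau}\mathrm{REC}$ are $\bigcup_i\Sigma_i$ and $\bigcup_i\Phi_i$; derivability is in conditional equational logic. $\mathcal P$ is the set of closed terms over $\bigcup_i\Sigma_i$. **Two-phase semantics.** A transition relation $t\xrightarrow{\alpha}s$ ($t\in\mathcal P$, $\alpha\in A_\tau\cup\{\sigma\}$, $s\in\mathcal P\cup\{\surd\}$) is an operational semantics if $t\xrightarrow{\alpha}s$ holds in it iff it can be deduced from the following rules under negative premises that hold in it. Here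 $a,b,c\in A_\tau$; $x\not\xrightarrow{\sigma}$ means that $x$ has no $\sigma$-transition; and in the rules for $a$-transitions of $\cdot,\parallel,\lfloor\!\lfloor,\mid,\partial_H,\tau_I$ each primed term may be $\surd$, with the conventions $\surd\cdot y=y$, $\surd\parallel y=y$, $x\parallel\surd=x$, $\surd\parallel\surd=\partial_H(\surd)=\tau_I(\surd)=\surd$. $\underline a\xrightarrow{a}\surd$. $\sigma(x)\xrightarrow{\sigma}x$. If $x\xrightarrow{a}s$ then $x+y\xrightarrow{a}s$, $y+x\xrightarrow{a}s$ and $\nu(x)\xrightarrow{a}s$. If $x\xrightarrow{\sigma}x'$ and $y\not\xrightarrow{\sigma}$ then $x+y\xrightarrow{\sigma}x'$ and $y+x\xrightarrow{\sigma}x'$. If $x\xrightarrow{a}x'$ then $x\cdot y\xrightarrow{a}x'\cdot y$, $x\parallel y\xrightarrow{a}x'\parallel y$, $y\parallel x\xrightarrow{a}y\parallel x'$, $x\lfloor\!\lfloor y\xrightarrow{a}x'\parallel y$; $\partial_H(x)\xrightarrow{a}\partial_H(x')$ if $a\notin H$; $\tau_I(x)\xrightarrow{a}\tau_I(x')$ if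 $a\notin I$ and $\tau_I(x)\xrightarrow{\tau}\tau_I(x')$ if $a\in I$. If $x\xrightarrow{a}x'$, $y\xrightarrow{b}y'$ and $\gamma(a,b)=c$ then $x\parallel y\xrightarrow{c}x'\parallel y'$ and $x\mid y\xrightarrow{c}x'\parallel y'$. If $x\xrightarrow{\sigma}x'$ then $x\cdot y\xrightarrow{\sigma}x'\cdot y$, $\partial_H(x)\xrightarrow{\sigma}\partial_H(x')$, $\tau_I(x)\xrightarrow{\sigma}\tau_I(x')$. If $x\xrightarrow{\sigma}x'$ and $y\xrightarrow{\sigma}y'$ then $x\mathbin{\square}y\xrightarrow{\sigma}x'\mathbin{\square}y'$ for $\square\in\{+,\parallel,\lfloor\!\lfloor,\mid\}$. If $\langle t|E\rangle\xrightarrow{\alpha}s$ and $X=t$ is in $E$ then $\langle X|E\rangle\xrightarrow{\alpha}s$. **Rooted branching bisimilarity.** $\surd$ has no transitions. A branching bisimulation is a relation $R$ on $\mathcal P\cup\{\surd\}$ such that both $R$ and its converse $S$ satisfy, for all $p,q$ with $R(p,q)$ (resp. $S(p,q)$), written here for $R$: (i) if $p\xrightarrow{\alpha}p'$, then either $\alpha=\tau$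 and $R(p',q)$, or there are $n\ge0$, $q=t_0\xrightarrow{\tau}t_1\cdots\xrightarrow{\tau}t_n\xrightarrow{\alpha}q'$ with $R(p,t_i)$ for $1\le i\le n$ and $R(p',q')$; (ii) if $p=\surd$, then there are $n\ge0$ and $q=t_0\xrightarrow{\tau}\cdots\xrightarrow{\tau}t_n=\surd$ with $R(\surd,t_i)$ for $1\le i\le n$. A pair $(p,q)\in\mathcal P\times\mathcal P$ satisfies the root condition in $R$ if every $p\xrightarrow{\alpha}p'$ is matched by some $q\xrightarrow{\alpha}q'$ with $R(p',q')$, and conversely. Terms $t_1,t_2\in\mathcal P$ are rooted branching bisimilar, $t_1\approx_{rb}t_2$, if there is a branching bisimulation $R$ with $R(t_1,t_2)$ such that, for every $n\ge0$ and all $t_1',t_2'$ reached from $t_1$, respectively $t_2$, by exactly $n$ transitions $\xrightarrow{\sigma}$ with $R(t_1',t_2')$, the pair $(t_1',t_2')$ satisfies the root condition in $R$. **Theorem (Soundness).** There is exactly one operational semantics as described, and with respect to it, for all $t,t'\in\mathcal P$: if $t=t'$ is derivable from the axioms of $\mathrm{ACP}_{drt}^{\tau}\mathrm{REC}$, then $t\approx_{rb}t'$.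 -/

import Mathlib

namespace DRT

universe u

/-! ### Actions -/

/-- Basic actions together with the silent step `τ`. -/
inductive Actt (A : Type u) : Type u
  | basic (a : A)
  | tau

/-- Basic actions together with the silent step `τ` and deadlock `δ`. -/
inductive Acttd (A : Type u) : Type u
  | ofActt (a : Actt A)
  | dead

/-- Labels of transitions: an action (possibly silent), or `σ` (idling till the next slice). -/
inductive Label (A : Type u) : Type u
  | act (a : Actt A)
  | sigma

variable {A : Type u}

/-- A basic action as a member of `A ∪ {τ, δ}`. -/
def Acttd.basic (a : A) : Acttd A := .ofActt (.basic a)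

/-- The silent step as a member of `A ∪ {τ, δ}`. -/
def Acttd.tau : Acttd A := .ofActt .tau

/-- Membership of an action (possibly silent) in a set of basic actions. -/
def Actt.In (a : Actt A) (H : Set A) : Prop := ∃ b ∈ H, a = .basic b

/-- Membership of an element of `A ∪ {τ, δ}` in a set of basic actions. -/
def Acttd.In (a : Acttd A) (H : Set A) : Prop := ∃ b ∈ H, a = .basic b

/-! ### Terms

Variables are natural numbers.  A set of recursion equations `{X = E X | X ∈ V}` is given by its
set `V` of variables and its right-hand sides `E : V → Term A`; it may be infinite.  `fix V E X`
is the recursion constant `⟨X | E⟩`.  Which of these preterms belong to the signature of the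
theory is singled out by `InSignature` below. -/

inductive Term (A : Type u) : Type u
  | var (X : ℕ)
  | cts (a : Acttd A)
  | alt (s t : Term A)
  | seq (s t : Term A)
  | delay (t : Term A)
  | par (s t : Term A)
  | lmerge (s t : Term A)
  | cmerge (s t : Term A)
  | encap (H : Set A) (t : Term A)
  | abstr (I : Set A) (t : Term A)
  | timeout (t : Term A)
  | fix (V : Set ℕ) (E : V → Term A) (X : V)

namespace Term

/-- The variables that occur in a term; a recursion constant is a constant. -/
def vars : Term A → Set ℕ
  | var X => {X}
  | cts _ => ∅
  | alt s t => s.vars ∪ t.vars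
  | seq s t => s.vars ∪ t.vars
  | delay t => t.vars
  | par s t => s.vars ∪ t.vars
  | lmerge s t => s.vars ∪ t.vars
  | cmerge s t => s.vars ∪ t.vars
  | encap _ t => t.vars
  | abstr _ t => t.vars
  | timeout t => t.vars
  | fix _ _ _ => ∅

/-- Simultaneous substitution of terms for variables. -/
def subst (θ : ℕ → Term A) : Term A → Term A
  | var X => θ X
  | cts a => cts a
  | alt s t => alt (s.subst θ) (t.subst θ)
  | seq s t => seq (s.subst θ) (t.subst θ)
  | delay t => delay (t.subst θ)
  | par s t => par (s.subst θ) (t.subst θ)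
  | lmerge s t => lmerge (s.subst θ) (t.subst θ)
  | cmerge s t => cmerge (s.subst θ) (t.subst θ)
  | encap H t => encap H (t.subst θ)
  | abstr I t => abstr I (t.subst θ)
  | timeout t => timeout (t.subst θ)
  | fix V E X => fix V E X

open Classical in
/-- `⟨t | E⟩`: every variable `X` of `E` is replaced in `t` by `⟨X | E⟩`. -/
noncomputable def close (V : Set ℕ) (E : V → Term A) (t : Term A) : Term A :=
  t.subst fun X => if h : X ∈ V then fix V E ⟨X, h⟩ else var X

/-- All recursion constants that occur in the term satisfy `C`, i.e. it is a term over the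
signature whose recursion constants are the `⟨X | E⟩` with `C E`. -/
def Over (C : (V : Set ℕ) → (V → Term A) → Prop) : Term A → Prop
  | var _ => True
  | cts _ => True
  | alt s t => s.Over C ∧ t.Over C
  | seq s t => s.Over C ∧ t.Over C
  | delay t => t.Over C
  | par s t => s.Over C ∧ t.Over C
  | lmerge s t => s.Over C ∧ t.Over C
  | cmerge s t => s.Over C ∧ t.Over C
  | encap _ t => t.Over C
  | abstr _ t => t.Over C
  | timeout t => t.Over C
  | fix V E _ => C V E

/-- No abstraction operator occurs in the term. -/
def NoAbstr : Term A → Prop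
  | var _ => True
  | cts _ => True
  | alt s t => s.NoAbstr ∧ t.NoAbstr
  | seq s t => s.NoAbstr ∧ t.NoAbstr
  | delay t => t.NoAbstr
  | par s t => s.NoAbstr ∧ t.NoAbstr
  | lmerge s t => s.NoAbstr ∧ t.NoAbstr
  | cmerge s t => s.NoAbstr ∧ t.NoAbstr
  | encap _ t => t.NoAbstr
  | abstr _ _ => False
  | timeout t => t.NoAbstr
  | fix _ _ _ => True

/-- Every occurrence of a variable lies in `t'` for some subterm of the form `a · t'`, with `a` a
basic action (so neither `τ` nor `δ`), or of the form `σ(t')`. -/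
def AllPrefixed : Term A → Prop
  | var _ => False
  | cts _ => True
  | alt s t => s.AllPrefixed ∧ t.AllPrefixed
  | seq s t => (∃ a : A, s = cts (.basic a)) ∨ (s.AllPrefixed ∧ t.AllPrefixed)
  | delay _ => True
  | par s t => s.AllPrefixed ∧ t.AllPrefixed
  | lmerge s t => s.AllPrefixed ∧ t.AllPrefixed
  | cmerge s t => s.AllPrefixed ∧ t.AllPrefixed
  | encap _ t => t.AllPrefixed
  | abstr _ t => t.AllPrefixed
  | timeout t => t.AllPrefixed
  | fix _ _ _ => True

/-- Guarded terms: all occurrences of variables are guarded.  Without variables there is nothing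
to guard; otherwise no abstraction operator may occur. -/
def Guarded (t : Term A) : Prop := t.vars = ∅ ∨ (t.NoAbstr ∧ t.AllPrefixed)

end Term

open Term

infixl:65 " ⊹ " => Term.alt
infixr:75 " ⊙ " => Term.seq
infixl:70 " ∥ " => Term.par
infixl:70 " ⫦ " => Term.lmerge
infixl:70 " ⦀ " => Term.cmerge

/-! ### Axioms without recursion -/

/-- `Ax γ s t`: the equation `s = t` is a substitution instance of one of the equational axioms
for the operators, where `γ` is the communication function. -/
inductive Ax (γ : Acttd A → Acttd A → Acttd A) : Term A → Term A → Prop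
  | A1 (x y) : Ax γ (x ⊹ y) (y ⊹ x)
  | A2 (x y z) : Ax γ ((x ⊹ y) ⊹ z) (x ⊹ (y ⊹ z))
  | A3 (x) : Ax γ (x ⊹ x) x
  | A4 (x y z) : Ax γ ((x ⊹ y) ⊙ z) ((x ⊙ z) ⊹ (y ⊙ z))
  | A5 (x y z) : Ax γ ((x ⊙ y) ⊙ z) (x ⊙ (y ⊙ z))
  | A6DR (x) : Ax γ (x ⊹ cts .dead) x
  | A7DR (x) : Ax γ (cts .dead ⊙ x) (cts .dead)
  | DRT1 (x y) : Ax γ (delay x ⊹ delay y) (delay (x ⊹ y))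
  | DRT2 (x y) : Ax γ (delay x ⊙ y) (delay (x ⊙ y))
  | D1DR (H) (a : Acttd A) : ¬ a.In H → Ax γ (encap H (cts a)) (cts a)
  | D2DR (H) (a : Acttd A) : a.In H → Ax γ (encap H (cts a)) (cts .dead)
  | D3 (H x y) : Ax γ (encap H (x ⊹ y)) (encap H x ⊹ encap H y)
  | D4 (H x y) : Ax γ (encap H (x ⊙ y)) (encap H x ⊙ encap H y)
  | DRD (H x) : Ax γ (encap H (delay x)) (delay (encap H x))
  | TI1DR (I) (a : Acttd A) : ¬ a.In I → Ax γ (abstr I (cts a)) (cts a)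
  | TI2DR (I) (a : Acttd A) : a.In I → Ax γ (abstr I (cts a)) (cts .tau)
  | TI3 (I x y) : Ax γ (abstr I (x ⊹ y)) (abstr I x ⊹ abstr I y)
  | TI4 (I x y) : Ax γ (abstr I (x ⊙ y)) (abstr I x ⊙ abstr I y)
  | DRTI (I x) : Ax γ (abstr I (delay x)) (delay (abstr I x))
  | CM1 (x y) : Ax γ (x ∥ y) (((x ⫦ y) ⊹ (y ⫦ x)) ⊹ (x ⦀ y))
  | CM2DR (a x) : Ax γ (cts a ⫦ x) (cts a ⊙ x)
  | CM3DR (a x y) : Ax γ ((cts a ⊙ x) ⫦ y) (cts a ⊙ (x ∥ y))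
  | DRCM1 (x y) : Ax γ (delay x ⫦ timeout y) (cts .dead)
  | DRCM2 (x y z) : Ax γ (delay x ⫦ (timeout y ⊹ delay z)) (delay (x ⫦ z))
  | CM4 (x y z) : Ax γ ((x ⊹ y) ⫦ z) ((x ⫦ z) ⊹ (y ⫦ z))
  | CM5DR (a b x) : Ax γ ((cts a ⊙ x) ⦀ cts b) ((cts a ⦀ cts b) ⊙ x)
  | CM6DR (a b x) : Ax γ (cts a ⦀ (cts b ⊙ x)) ((cts a ⦀ cts b) ⊙ x)
  | CM7DR (a b x y) : Ax γ ((cts a ⊙ x) ⦀ (cts b ⊙ y)) ((cts a ⦀ cts b) ⊙ (x ∥ y))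
  | DRCM3 (x y) : Ax γ (timeout x ⦀ delay y) (cts .dead)
  | DRCM4 (x y) : Ax γ (delay x ⦀ timeout y) (cts .dead)
  | DRCM5 (x y) : Ax γ (delay x ⦀ delay y) (delay (x ⦀ y))
  | CM8 (x y z) : Ax γ ((x ⊹ y) ⦀ z) ((x ⦀ z) ⊹ (y ⦀ z))
  | CM9 (x y z) : Ax γ (x ⦀ (y ⊹ z)) ((x ⦀ y) ⊹ (x ⦀ z))
  | CFDR (a b c) : γ a b = c → Ax γ (cts a ⦀ cts b) (cts c)
  | DRTO1 (a) : Ax γ (timeout (cts a)) (cts a)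
  | DRTO2 (x y) : Ax γ (timeout (x ⊹ y)) (timeout x ⊹ timeout y)
  | DRTO3 (x y) : Ax γ (timeout (x ⊙ y)) (timeout x ⊙ y)
  | DRTO4 (x) : Ax γ (timeout (delay x)) (cts .dead)
  | DRB1 (a) : Ax γ (cts a ⊙ cts .tau) (cts a)
  | DRB2 (a x y) : Ax γ (cts a ⊙ ((cts .tau ⊙ (timeout x ⊹ y)) ⊹ timeout x))
      (cts a ⊙ (timeout x ⊹ y))
  | DRB3 (a x y) : Ax γ (cts a ⊙ ((cts .tau ⊙ (timeout x ⊹ y)) ⊹ y))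
      (cts a ⊙ (timeout x ⊹ y))
  | DRB4 (a x y) : Ax γ (cts a ⊙ (delay (cts .tau ⊙ x) ⊹ timeout y))
      (cts a ⊙ (delay x ⊹ timeout y))

/-! ### Guarded recursion, nested to arbitrary finite depth -/

/-- `Eqn γ C s t`: `s = t` is an instance, over the signature with recursion constants `C`, of an
equational axiom for the operators or of RDP for a recursion constant in `C`. -/
inductive Eqn (γ : Acttd A → Acttd A → Acttd A) (C : (V : Set ℕ) → (V → Term A) → Prop) :
    Term A → Term A → Prop
  | ax {s t} : Ax γ s t → s.Over C → t.Over C → Eqn γ C s t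
  | rdp (V : Set ℕ) (E : V → Term A) (X : V) : C V E → Eqn γ C (fix V E X) (close V E (E X))

/-- `Rewr γ C V E X s t`: `s` is rewritable to `t` by applying, anywhere in the term, equations
of `Eqn γ C` in either direction and the equations `Y = E Y` with `Y ≠ X` from left to right. -/
inductive Rewr (γ : Acttd A → Acttd A → Acttd A) (C : (V : Set ℕ) → (V → Term A) → Prop)
    (V : Set ℕ) (E : V → Term A) (X : V) : Term A → Term A → Prop
  | left_right {s t} : Eqn γ C s t → Rewr γ C V E X s t
  | right_left {s t} : Eqn γ C s t → Rewr γ C V E X t s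
  | unfold (Y : V) : Y ≠ X → Rewr γ C V E X (var Y) (E Y)
  | refl (s) : Rewr γ C V E X s s
  | trans {s t r} : Rewr γ C V E X s t → Rewr γ C V E X t r → Rewr γ C V E X s r
  | alt {s s' t t'} : Rewr γ C V E X s s' → Rewr γ C V E X t t' →
      Rewr γ C V E X (s ⊹ t) (s' ⊹ t')
  | seq {s s' t t'} : Rewr γ C V E X s s' → Rewr γ C V E X t t' →
      Rewr γ C V E X (s ⊙ t) (s' ⊙ t')
  | delay {t t'} : Rewr γ C V E X t t' → Rewr γ C V E X (delay t) (delay t')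
  | par {s s' t t'} : Rewr γ C V E X s s' → Rewr γ C V E X t t' →
      Rewr γ C V E X (s ∥ t) (s' ∥ t')
  | lmerge {s s' t t'} : Rewr γ C V E X s s' → Rewr γ C V E X t t' →
      Rewr γ C V E X (s ⫦ t) (s' ⫦ t')
  | cmerge {s s' t t'} : Rewr γ C V E X s s' → Rewr γ C V E X t t' →
      Rewr γ C V E X (s ⦀ t) (s' ⦀ t')
  | encap (H) {t t'} : Rewr γ C V E X t t' → Rewr γ C V E X (encap H t) (encap H t')
  | abstr (I) {t t'} : Rewr γ C V E X t t' → Rewr γ C V E X (abstr I t) (abstr I t')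
  | timeout {t t'} : Rewr γ C V E X t t' → Rewr γ C V E X (timeout t) (timeout t')

/-- `E` is a recursive specification over the signature with recursion constants `C` that is
guarded modulo the equations `Eqn γ C`. -/
def GuardedSpec (γ : Acttd A → Acttd A → Acttd A) (C : (V : Set ℕ) → (V → Term A) → Prop)
    (V : Set ℕ) (E : V → Term A) : Prop :=
  ∀ X : V, (E X).Over C ∧ (E X).vars ⊆ V ∧ ∃ g, Rewr γ C V E X (E X) g ∧ g.Guarded

/-- The specifications `E` whose constants `⟨X | E⟩` belong to the `i`-th signature. -/
def SpecLevel (γ : Acttd A → Acttd A → Acttd A) :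
    ℕ → (V : Set ℕ) → (V → Term A) → Prop
  | 0 => fun _ _ => False
  | i + 1 => fun V E => SpecLevel γ i V E ∨ GuardedSpec γ (SpecLevel γ i) V E

/-- The specifications `E` whose constants `⟨X | E⟩` belong to the signature of the theory. -/
def IsSpec (γ : Acttd A → Acttd A → Acttd A) (V : Set ℕ) (E : V → Term A) : Prop :=
  ∃ i, SpecLevel γ i V E

/-- Terms (possibly open) over the signature of the theory with recursion. -/
def InSignature (γ : Acttd A → Acttd A → Acttd A) (t : Term A) : Prop := t.Over (IsSpec γ)

/-- Process terms: the closed terms over the signature of the theory with recursion. -/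
def IsProc (γ : Acttd A → Acttd A → Acttd A) (t : Term A) : Prop :=
  t.vars = ∅ ∧ InSignature γ t

/-! ### Derivability in conditional equational logic -/

/-- `Deriv γ s t`: the equation `s = t` between terms over the signature is derivable from the
axioms, RDP and RSP.  Axioms are used through their substitution instances; the rule `rsp`
applies an arbitrary substitution instance of the conditional equation `E ⇒ X = ⟨X | E⟩`. -/
inductive Deriv (γ : Acttd A → Acttd A → Acttd A) : Term A → Term A → Prop
  | ax {s t} : Ax γ s t → InSignature γ s → InSignature γ t → Deriv γ s t
  | rdp (V : Set ℕ) (E : V → Term A) (X : V) : IsSpec γ V E →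
      Deriv γ (fix V E X) (close V E (E X))
  | rsp (V : Set ℕ) (E : V → Term A) (X : V) (θ : ℕ → Term A) : IsSpec γ V E →
      (∀ Y : V, Deriv γ (θ Y) ((E Y).subst θ)) → Deriv γ (θ X) (fix V E X)
  | refl (t) : InSignature γ t → Deriv γ t t
  | symm {s t} : Deriv γ s t → Deriv γ t s
  | trans {s t r} : Deriv γ s t → Deriv γ t r → Deriv γ s r
  | alt {s s' t t'} : Deriv γ s s' → Deriv γ t t' → Deriv γ (s ⊹ t) (s' ⊹ t')
  | seq {s s' t t'} : Deriv γ s s' → Deriv γ t t' → Deriv γ (s ⊙ t) (s' ⊙ t')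
  | delay {t t'} : Deriv γ t t' → Deriv γ (delay t) (delay t')
  | par {s s' t t'} : Deriv γ s s' → Deriv γ t t' → Deriv γ (s ∥ t) (s' ∥ t')
  | lmerge {s s' t t'} : Deriv γ s s' → Deriv γ t t' → Deriv γ (s ⫦ t) (s' ⫦ t')
  | cmerge {s s' t t'} : Deriv γ s s' → Deriv γ t t' → Deriv γ (s ⦀ t) (s' ⦀ t')
  | encap (H) {t t'} : Deriv γ t t' → Deriv γ (encap H t) (encap H t')
  | abstr (I) {t t'} : Deriv γ t t' → Deriv γ (abstr I t) (abstr I t')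
  | timeout {t t'} : Deriv γ t t' → Deriv γ (timeout t) (timeout t')

/-! ### Two-phase operational semantics

A state is a term or `none`, which stands for successful termination `√`. -/

/-- `Step γ N t α s`: the transition from `t` to `s` with label `α` can be deduced from the
transition rules under the negative assumptions `N`, where `N y` is the assumption that `y`
cannot idle till the next time slice. -/
inductive Step (γ : Acttd A → Acttd A → Acttd A) (N : Term A → Prop) :
    Term A → Label A → Option (Term A) → Prop
  | cts (a) : Step γ N (cts (.ofActt a)) (.act a) none
  | alt_left {x y a s} : Step γ N x (.act a) s → Step γ N (x ⊹ y) (.act a) s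
  | alt_right {x y a s} : Step γ N y (.act a) s → Step γ N (x ⊹ y) (.act a) s
  | alt_idle_left {x y x'} : Step γ N x .sigma (some x') → N y →
      Step γ N (x ⊹ y) .sigma (some x')
  | alt_idle_right {x y y'} : N x → Step γ N y .sigma (some y') →
      Step γ N (x ⊹ y) .sigma (some y')
  | alt_idle {x y x' y'} : Step γ N x .sigma (some x') → Step γ N y .sigma (some y') →
      Step γ N (x ⊹ y) .sigma (some (x' ⊹ y'))
  | seq {x y a x'} : Step γ N x (.act a) (some x') →
      Step γ N (x ⊙ y) (.act a) (some (x' ⊙ y))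
  | seq_term {x y a} : Step γ N x (.act a) none → Step γ N (x ⊙ y) (.act a) (some y)
  | seq_idle {x y x'} : Step γ N x .sigma (some x') →
      Step γ N (x ⊙ y) .sigma (some (x' ⊙ y))
  | delay (x) : Step γ N (delay x) .sigma (some x)
  | par_left {x y a x'} : Step γ N x (.act a) (some x') →
      Step γ N (x ∥ y) (.act a) (some (x' ∥ y))
  | par_right {x y a y'} : Step γ N y (.act a) (some y') →
      Step γ N (x ∥ y) (.act a) (some (x ∥ y'))
  | par_left_term {x y a} : Step γ N x (.act a) none → Step γ N (x ∥ y) (.act a) (some y)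
  | par_right_term {x y a} : Step γ N y (.act a) none → Step γ N (x ∥ y) (.act a) (some x)
  | par_comm {x y a b c x' y'} : Step γ N x (.act a) (some x') →
      Step γ N y (.act b) (some y') → γ (.ofActt a) (.ofActt b) = .ofActt c →
      Step γ N (x ∥ y) (.act c) (some (x' ∥ y'))
  | par_comm_right_term {x y a b c x'} : Step γ N x (.act a) (some x') →
      Step γ N y (.act b) none → γ (.ofActt a) (.ofActt b) = .ofActt c →
      Step γ N (x ∥ y) (.act c) (some x')
  | par_comm_left_term {x y a b c y'} : Step γ N x (.act a) none →
      Step γ N y (.act b) (some y') → γ (.ofActt a) (.ofActt b) = .ofActt c →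
      Step γ N (x ∥ y) (.act c) (some y')
  | par_comm_term {x y a b c} : Step γ N x (.act a) none →
      Step γ N y (.act b) none → γ (.ofActt a) (.ofActt b) = .ofActt c →
      Step γ N (x ∥ y) (.act c) none
  | par_idle {x y x' y'} : Step γ N x .sigma (some x') → Step γ N y .sigma (some y') →
      Step γ N (x ∥ y) .sigma (some (x' ∥ y'))
  | lmerge {x y a x'} : Step γ N x (.act a) (some x') →
      Step γ N (x ⫦ y) (.act a) (some (x' ∥ y))
  | lmerge_term {x y a} : Step γ N x (.act a) none → Step γ N (x ⫦ y) (.act a) (some y)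
  | lmerge_idle {x y x' y'} : Step γ N x .sigma (some x') → Step γ N y .sigma (some y') →
      Step γ N (x ⫦ y) .sigma (some (x' ⫦ y'))
  | cmerge {x y a b c x' y'} : Step γ N x (.act a) (some x') →
      Step γ N y (.act b) (some y') → γ (.ofActt a) (.ofActt b) = .ofActt c →
      Step γ N (x ⦀ y) (.act c) (some (x' ∥ y'))
  | cmerge_right_term {x y a b c x'} : Step γ N x (.act a) (some x') →
      Step γ N y (.act b) none → γ (.ofActt a) (.ofActt b) = .ofActt c →
      Step γ N (x ⦀ y) (.act c) (some x')
  | cmerge_left_term {x y a b c y'} : Step γ N x (.act a) none →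
      Step γ N y (.act b) (some y') → γ (.ofActt a) (.ofActt b) = .ofActt c →
      Step γ N (x ⦀ y) (.act c) (some y')
  | cmerge_term {x y a b c} : Step γ N x (.act a) none →
      Step γ N y (.act b) none → γ (.ofActt a) (.ofActt b) = .ofActt c →
      Step γ N (x ⦀ y) (.act c) none
  | cmerge_idle {x y x' y'} : Step γ N x .sigma (some x') → Step γ N y .sigma (some y') →
      Step γ N (x ⦀ y) .sigma (some (x' ⦀ y'))
  | encap {H x a x'} : Step γ N x (.act a) (some x') → ¬ a.In H →
      Step γ N (encap H x) (.act a) (some (encap H x'))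
  | encap_term {H x a} : Step γ N x (.act a) none → ¬ a.In H →
      Step γ N (encap H x) (.act a) none
  | encap_idle {H x x'} : Step γ N x .sigma (some x') →
      Step γ N (encap H x) .sigma (some (encap H x'))
  | abstr {I x a x'} : Step γ N x (.act a) (some x') → ¬ a.In I →
      Step γ N (abstr I x) (.act a) (some (abstr I x'))
  | abstr_term {I x a} : Step γ N x (.act a) none → ¬ a.In I →
      Step γ N (abstr I x) (.act a) none
  | abstr_hide {I x a x'} : Step γ N x (.act a) (some x') → a.In I →
      Step γ N (abstr I x) (.act .tau) (some (abstr I x'))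
  | abstr_hide_term {I x a} : Step γ N x (.act a) none → a.In I →
      Step γ N (abstr I x) (.act .tau) none
  | abstr_idle {I x x'} : Step γ N x .sigma (some x') →
      Step γ N (abstr I x) .sigma (some (abstr I x'))
  | timeout {x a s} : Step γ N x (.act a) s → Step γ N (timeout x) (.act a) s
  | fix {V : Set ℕ} {E : V → Term A} {X : V} {α s} : Step γ N (close V E (E X)) α s →
      Step γ N (fix V E X) α s

/-- `T` is a two-phase operational semantics of the process terms: a transition holds in `T` iff
it can be deduced from the transition rules under the negative assumptions that hold in `T`. -/
def IsOpSem (γ : Acttd A → Acttd A → Acttd A)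
    (T : Term A → Label A → Option (Term A) → Prop) : Prop :=
  ∀ t α s, T t α s ↔ IsProc γ t ∧ Step γ (fun y => ∀ y', ¬ T y .sigma (some y')) t α s

/-! ### Rooted branching bisimilarity -/

/-- Transitions between states; `√` has none. -/
def Trans (T : Term A → Label A → Option (Term A) → Prop) :
    Option (Term A) → Label A → Option (Term A) → Prop
  | some t, α, s => T t α s
  | none, _, _ => False

/-- `Silent T R p q q'`: there are `q = t₀, …, tₙ = q'`, `n ≥ 0`, with a silent step from `tᵢ` to
`tᵢ₊₁` and `R p tᵢ₊₁` for all `i < n`. -/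
def Silent (T : Term A → Label A → Option (Term A) → Prop)
    (R : Option (Term A) → Option (Term A) → Prop) (p : Option (Term A)) :
    Option (Term A) → Option (Term A) → Prop :=
  Relation.ReflTransGen fun u v => Trans T u (.act .tau) v ∧ R p v

/-- The transfer condition in one direction.  Its second part says that successful termination is
matched by successful termination, possibly after silent steps. -/
def Transfer (T : Term A → Label A → Option (Term A) → Prop)
    (R : Option (Term A) → Option (Term A) → Prop) : Prop :=
  ∀ p q, R p q →
    (∀ α p', Trans T p α p' →
      (α = .act .tau ∧ R p' q) ∨
        ∃ r q', Silent T R p q r ∧ Trans T r α q' ∧ R p' q') ∧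
    (p = none → Silent T R p q none)

/-- Branching bisimulations on the set of process terms and `√`. -/
structure IsBranchingBisim (γ : Acttd A → Acttd A → Acttd A)
    (T : Term A → Label A → Option (Term A) → Prop)
    (R : Option (Term A) → Option (Term A) → Prop) : Prop where
  proc : ∀ p q, R p q → (∀ t ∈ p, IsProc γ t) ∧ (∀ t ∈ q, IsProc γ t)
  forth : Transfer T R
  back : Transfer T (flip R)

/-- The pair `(t₁, t₂)` satisfies the root condition in `R`. -/
def RootCondition (T : Term A → Label A → Option (Term A) → Prop)
    (R : Option (Term A) → Option (Term A) → Prop) (t₁ t₂ : Term A) : Prop :=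
  (∀ α s₁, T t₁ α s₁ → ∃ s₂, T t₂ α s₂ ∧ R s₁ s₂) ∧
  (∀ α s₂, T t₂ α s₂ → ∃ s₁, T t₁ α s₁ ∧ R s₁ s₂)

/-- `Idles T n t t'`: `t'` is reached from `t` by idling during exactly `n` time slices. -/
def Idles (T : Term A → Label A → Option (Term A) → Prop) : ℕ → Term A → Term A → Prop
  | 0, t, t' => t = t'
  | n + 1, t, t' => ∃ u, T t .sigma (some u) ∧ Idles T n u t'

/-- Rooted branching bisimilarity: some branching bisimulation relates `t₁` and `t₂`, and every
related pair of terms reached from `t₁` and `t₂` by idling equally long satisfies the root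
condition. -/
def RootedBranchingBisim (γ : Acttd A → Acttd A → Acttd A)
    (T : Term A → Label A → Option (Term A) → Prop) (t₁ t₂ : Term A) : Prop :=
  ∃ R, IsBranchingBisim γ T R ∧ R (some t₁) (some t₂) ∧
    ∀ n t₁' t₂', Idles T n t₁ t₁' → Idles T n t₂ t₂' → R (some t₁') (some t₂') →
      RootCondition T R t₁' t₂'

end DRT

namespace DRT

-- The obstacle to existence and uniqueness of the operational semantics is the negative premise in
-- the rules for choice: recursion allows the ability of a term to idle to depend on itself. The
-- proof replaces "cannot idle" by the inductive predicate `IdleVal t false`, so that evaluation of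
-- idling is three-valued: true, false, or undecided, as for a constant with the single equation X =
-- X. The resulting relation `Tr γ` is defined on all preterms by a plain induction, and it is
-- time-deterministic.
--
-- Soundness is proved for `Tr γ` before anything is known about totality of the evaluation. Two
-- relations are used. `BB` is branching bisimilarity on states; it is a congruence for sequencing,
-- merge, encapsulation and abstraction (`BB.seqO`, `BB.parO`, `BB.map`). `RB` is a coinductive
-- rooted version: actions are matched step by step up to `BB`, idling is matched up to `RB` again,
-- and the value `false` is preserved. `RB` is a congruence for all operators. Axiom instances are
-- closed under idling, up to equality, and their action steps lead to `BB`-related states, so they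
-- lie in `RB` (`Ax.rb`).
--
-- For RSP, two solutions of a guarded specification are compared by bisimulation up to contexts.
-- Related solutions rewrite, up to `RB`, to a guarded context filled with related solutions
-- (`Rewr.rb`, `gctx_subst`). A guard is a visible action or a delay, abstraction is absent, and
-- communication never yields τ; hence a silent step of a guarded context leaves all guards in place
-- (`GCtx.tr`). This makes up-to reasoning legitimate despite the silent paths allowed in matching
-- (`TransferTo.comp`, `Ctx.bb`), and gives `RB.of_solutions`, hence `Deriv.rb`.
--
-- The same soundness of rewriting then shows that idling of process terms is decided: a guarded
-- form has a value by structure, and `RB` carries it back to the recursion constant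
-- (`SpecLevel.exists_idleVal`). With every process decided, `Tr γ` restricted to processes is an
-- operational semantics, and any other one has the same negative premises (`IsOpSem.eq_procTr`).
-- Finally `RB` implies rooted branching bisimilarity, since time determinism keeps equally delayed
-- descendants in `RB`.

universe u

variable {A : Type u}

/-! ### Three-valued evaluation of the ability to idle -/

/-- `IdleVal t b`: it can be decided, by finitely many unfoldings of recursion constants, that `t`
can (`b = true`) or cannot (`b = false`) idle till the next time slice. -/
inductive IdleVal : Term A → Bool → Prop
  | cts (a) : IdleVal (.cts a) false
  | delay (x) : IdleVal (.delay x) true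
  | timeout (x) : IdleVal (.timeout x) false
  | alt {x y b c} : IdleVal x b → IdleVal y c → IdleVal (x ⊹ y) (b || c)
  | seq {x y b} : IdleVal x b → IdleVal (x ⊙ y) b
  | par {x y} : IdleVal x true → IdleVal y true → IdleVal (x ∥ y) true
  | par_left {x y} : IdleVal x false → IdleVal (x ∥ y) false
  | par_right {x y} : IdleVal y false → IdleVal (x ∥ y) false
  | lmerge {x y} : IdleVal x true → IdleVal y true → IdleVal (x ⫦ y) true
  | lmerge_left {x y} : IdleVal x false → IdleVal (x ⫦ y) false
  | lmerge_right {x y} : IdleVal y false → IdleVal (x ⫦ y) false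
  | cmerge {x y} : IdleVal x true → IdleVal y true → IdleVal (x ⦀ y) true
  | cmerge_left {x y} : IdleVal x false → IdleVal (x ⦀ y) false
  | cmerge_right {x y} : IdleVal y false → IdleVal (x ⦀ y) false
  | encap {H x b} : IdleVal x b → IdleVal (.encap H x) b
  | abstr {I x b} : IdleVal x b → IdleVal (.abstr I x) b
  | fix {V : Set ℕ} {E : V → Term A} {X : V} {b} : IdleVal (Term.close V E (E X)) b →
      IdleVal (.fix V E X) b

/-- The overlapping rules for the merges agree: the value `true` needs both operands `true`, which
by induction excludes a `false` operand. -/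
theorem IdleVal.unique {t : Term A} {b c : Bool} (h : IdleVal t b) (h' : IdleVal t c) :
    b = c := by
  induction h generalizing c with
  | alt _ _ ih₁ ih₂ => cases h' with | alt h₁ h₂ => rw [ih₁ h₁, ih₂ h₂]
  | _ => cases h' <;> grind

theorem IdleVal.not_true_of_false {t : Term A} (h : IdleVal t false) : ¬ IdleVal t true :=
  fun h' => Bool.noConfusion (h.unique h')

@[simp] theorem idleVal_cts_false (a : Acttd A) : IdleVal (.cts a) false := .cts a

@[simp] theorem idleVal_delay_false (x : Term A) : ¬ IdleVal (.delay x) false := nofun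

@[simp] theorem idleVal_timeout_false (x : Term A) : IdleVal (.timeout x) false := .timeout x

@[simp] theorem idleVal_alt_false (x y : Term A) :
    IdleVal (x ⊹ y) false ↔ IdleVal x false ∧ IdleVal y false := by
  refine ⟨fun h => ?_, fun h => .alt h.1 h.2⟩
  generalize hb : false = b at h
  cases h with
  | @alt _ _ b c h₁ h₂ => cases b <;> cases c <;> first | exact ⟨h₁, h₂⟩ | cases hb

@[simp] theorem idleVal_seq (x y : Term A) (b) : IdleVal (x ⊙ y) b ↔ IdleVal x b :=
  ⟨fun h => by cases h; assumption, .seq⟩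

@[simp] theorem idleVal_par_false (x y : Term A) :
    IdleVal (x ∥ y) false ↔ IdleVal x false ∨ IdleVal y false :=
  ⟨fun h => by cases h <;> simp_all, fun h => h.elim .par_left .par_right⟩

@[simp] theorem idleVal_lmerge_false (x y : Term A) :
    IdleVal (x ⫦ y) false ↔ IdleVal x false ∨ IdleVal y false :=
  ⟨fun h => by cases h <;> simp_all, fun h => h.elim .lmerge_left .lmerge_right⟩

@[simp] theorem idleVal_cmerge_false (x y : Term A) :
    IdleVal (x ⦀ y) false ↔ IdleVal x false ∨ IdleVal y false :=
  ⟨fun h => by cases h <;> simp_all, fun h => h.elim .cmerge_left .cmerge_right⟩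

@[simp] theorem idleVal_encap (H) (x : Term A) (b) : IdleVal (.encap H x) b ↔ IdleVal x b :=
  ⟨fun h => by cases h; assumption, .encap⟩

@[simp] theorem idleVal_abstr (I) (x : Term A) (b) : IdleVal (.abstr I x) b ↔ IdleVal x b :=
  ⟨fun h => by cases h; assumption, .abstr⟩

@[simp] theorem idleVal_fix (V : Set ℕ) (E : V → Term A) (X : V) (b) :
    IdleVal (.fix V E X) b ↔ IdleVal (Term.close V E (E X)) b :=
  ⟨fun h => by cases h; assumption, .fix⟩

/-! ### Transitions, with negative premises read as decided inability to idle -/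

variable {γ : Acttd A → Acttd A → Acttd A}

/-- The transition relation in which the negative premise for `y` is `IdleVal y false`. -/
def Tr (γ : Acttd A → Acttd A → Acttd A) : Term A → Label A → Option (Term A) → Prop :=
  Step γ fun y => IdleVal y false

/-- Sequencing after a state that may be `√`. -/
def seqO : Option (Term A) → Term A → Term A
  | none, y => y
  | some x, y => x ⊙ y

/-- Merge of states that may be `√`. -/
def parO : Option (Term A) → Option (Term A) → Option (Term A)
  | none, q => q
  | some x, none => some x
  | some x, some y => some (x ∥ y)

@[simp] theorem seqO_none (y : Term A) : seqO none y = y := rfl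
@[simp] theorem seqO_some (x y : Term A) : seqO (some x) y = x ⊙ y := rfl
@[simp] theorem parO_none_left (q : Option (Term A)) : parO none q = q := rfl
@[simp] theorem parO_none_right (p : Option (Term A)) : parO p none = p := by cases p <;> rfl
@[simp] theorem parO_some (x y : Term A) : parO (some x) (some y) = some (x ∥ y) := rfl

open Classical in
/-- The label that abstraction from `I` makes of an action. -/
noncomputable def hide (I : Set A) (a : Actt A) : Actt A := if a.In I then .tau else a

theorem Step.sigma_isSome {N : Term A → Prop} {t : Term A} {α s} (h : Step γ N t α s) :
    α = .sigma → ∃ s', s = some s' := by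
  induction h <;> simp_all

@[simp] theorem tr_cts (a : Acttd A) (α s) :
    Tr γ (.cts a) α s ↔ ∃ b, a = .ofActt b ∧ α = .act b ∧ s = none := by
  constructor
  · intro h; cases h; simp
  · rintro ⟨b, rfl, rfl, rfl⟩; exact .cts b

@[simp] theorem tr_alt_act (x y : Term A) (a s) :
    Tr γ (x ⊹ y) (.act a) s ↔ Tr γ x (.act a) s ∨ Tr γ y (.act a) s := by
  constructor
  · intro h; cases h <;> simp_all [Tr]
  · rintro (h | h)
    exacts [.alt_left h, .alt_right h]

@[simp] theorem tr_alt_sigma (x y : Term A) (s) :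
    Tr γ (x ⊹ y) .sigma s ↔ (Tr γ x .sigma s ∧ IdleVal y false) ∨
      (IdleVal x false ∧ Tr γ y .sigma s) ∨
      ∃ x' y', Tr γ x .sigma (some x') ∧ Tr γ y .sigma (some y') ∧ s = some (x' ⊹ y') := by
  constructor
  · intro h; cases h <;> simp_all [Tr]
  · rintro (⟨h, h'⟩ | ⟨h, h'⟩ | ⟨x', y', h, h', rfl⟩)
    · obtain ⟨s, rfl⟩ := Step.sigma_isSome h rfl
      exact .alt_idle_left h h'
    · obtain ⟨s, rfl⟩ := Step.sigma_isSome h' rfl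
      exact .alt_idle_right h h'
    · exact .alt_idle h h'

@[simp] theorem tr_seq (x y : Term A) (α s) :
    Tr γ (x ⊙ y) α s ↔ ∃ x', Tr γ x α x' ∧ s = some (seqO x' y) := by
  constructor
  · intro h; cases h <;> exact ⟨_, ‹_›, rfl⟩
  · rintro ⟨x', h, rfl⟩
    cases α with
    | act a =>
      cases x' with
      | none => exact .seq_term h
      | some x' => exact .seq h
    | sigma =>
      obtain ⟨s, rfl⟩ := Step.sigma_isSome h rfl
      exact .seq_idle h

@[simp] theorem tr_delay (x : Term A) (α s) :
    Tr γ (.delay x) α s ↔ α = .sigma ∧ s = some x := by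
  constructor
  · intro h; cases h; simp
  · rintro ⟨rfl, rfl⟩; exact .delay x

@[simp] theorem tr_par_act (x y : Term A) (c s) :
    Tr γ (x ∥ y) (.act c) s ↔ (∃ x', Tr γ x (.act c) x' ∧ s = parO x' (some y)) ∨
      (∃ y', Tr γ y (.act c) y' ∧ s = parO (some x) y') ∨
      ∃ a b x' y', Tr γ x (.act a) x' ∧ Tr γ y (.act b) y' ∧
        γ (.ofActt a) (.ofActt b) = .ofActt c ∧ s = parO x' y' := by
  constructor
  · intro h
    cases h with
    | par_left h => exact .inl ⟨_, h, rfl⟩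
    | par_left_term h => exact .inl ⟨_, h, rfl⟩
    | par_right h => exact .inr (.inl ⟨_, h, rfl⟩)
    | par_right_term h => exact .inr (.inl ⟨_, h, rfl⟩)
    | par_comm h h' e => exact .inr (.inr ⟨_, _, _, _, h, h', e, rfl⟩)
    | par_comm_left_term h h' e => exact .inr (.inr ⟨_, _, _, _, h, h', e, rfl⟩)
    | par_comm_right_term h h' e => exact .inr (.inr ⟨_, _, _, _, h, h', e, rfl⟩)
    | par_comm_term h h' e => exact .inr (.inr ⟨_, _, _, _, h, h', e, rfl⟩)
  · rintro (⟨x', h, rfl⟩ | ⟨y', h, rfl⟩ | ⟨a, b, x', y', h, h', e, rfl⟩)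
    · cases x' with
      | none => exact .par_left_term h
      | some x' => exact .par_left h
    · cases y' with
      | none => exact .par_right_term h
      | some y' => exact .par_right h
    · cases x' <;> cases y'
      · exact .par_comm_term h h' e
      · exact .par_comm_left_term h h' e
      · exact .par_comm_right_term h h' e
      · exact .par_comm h h' e

@[simp] theorem tr_par_sigma (x y : Term A) (s) :
    Tr γ (x ∥ y) .sigma s ↔
      ∃ x' y', Tr γ x .sigma (some x') ∧ Tr γ y .sigma (some y') ∧ s = some (x' ∥ y') := by
  constructor
  · intro h; cases h; exact ⟨_, _, ‹_›, ‹_›, rfl⟩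
  · rintro ⟨x', y', h, h', rfl⟩; exact .par_idle h h'

@[simp] theorem tr_lmerge_act (x y : Term A) (c s) :
    Tr γ (x ⫦ y) (.act c) s ↔ ∃ x', Tr γ x (.act c) x' ∧ s = parO x' (some y) := by
  constructor
  · intro h; cases h <;> exact ⟨_, ‹_›, rfl⟩
  · rintro ⟨x', h, rfl⟩
    cases x' with
    | none => exact .lmerge_term h
    | some x' => exact .lmerge h

@[simp] theorem tr_lmerge_sigma (x y : Term A) (s) :
    Tr γ (x ⫦ y) .sigma s ↔
      ∃ x' y', Tr γ x .sigma (some x') ∧ Tr γ y .sigma (some y') ∧ s = some (x' ⫦ y') := by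
  constructor
  · intro h; cases h; exact ⟨_, _, ‹_›, ‹_›, rfl⟩
  · rintro ⟨x', y', h, h', rfl⟩; exact .lmerge_idle h h'

@[simp] theorem tr_cmerge_act (x y : Term A) (c s) :
    Tr γ (x ⦀ y) (.act c) s ↔ ∃ a b x' y', Tr γ x (.act a) x' ∧ Tr γ y (.act b) y' ∧
        γ (.ofActt a) (.ofActt b) = .ofActt c ∧ s = parO x' y' := by
  constructor
  · intro h
    cases h with
    | cmerge h h' e => exact ⟨_, _, _, _, h, h', e, rfl⟩
    | cmerge_left_term h h' e => exact ⟨_, _, _, _, h, h', e, rfl⟩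
    | cmerge_right_term h h' e => exact ⟨_, _, _, _, h, h', e, rfl⟩
    | cmerge_term h h' e => exact ⟨_, _, _, _, h, h', e, rfl⟩
  · rintro ⟨a, b, x', y', h, h', e, rfl⟩
    cases x' <;> cases y'
    · exact .cmerge_term h h' e
    · exact .cmerge_left_term h h' e
    · exact .cmerge_right_term h h' e
    · exact .cmerge h h' e

@[simp] theorem tr_cmerge_sigma (x y : Term A) (s) :
    Tr γ (x ⦀ y) .sigma s ↔
      ∃ x' y', Tr γ x .sigma (some x') ∧ Tr γ y .sigma (some y') ∧ s = some (x' ⦀ y') := by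
  constructor
  · intro h; cases h; exact ⟨_, _, ‹_›, ‹_›, rfl⟩
  · rintro ⟨x', y', h, h', rfl⟩; exact .cmerge_idle h h'

@[simp] theorem tr_encap_act (H) (x : Term A) (a s) :
    Tr γ (.encap H x) (.act a) s ↔
      ∃ x', Tr γ x (.act a) x' ∧ ¬ a.In H ∧ s = x'.map (.encap H) := by
  constructor
  · intro h; cases h <;> exact ⟨_, ‹_›, ‹_›, rfl⟩
  · rintro ⟨x', h, h', rfl⟩
    cases x' with
    | none => exact .encap_term h h'
    | some x' => exact .encap h h'

@[simp] theorem tr_encap_sigma (H) (x : Term A) (s) :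
    Tr γ (.encap H x) .sigma s ↔ ∃ x', Tr γ x .sigma (some x') ∧ s = some (.encap H x') := by
  constructor
  · intro h; cases h; exact ⟨_, ‹_›, rfl⟩
  · rintro ⟨x', h, rfl⟩; exact .encap_idle h

@[simp] theorem tr_abstr_act (I) (x : Term A) (b s) :
    Tr γ (.abstr I x) (.act b) s ↔
      ∃ a x', Tr γ x (.act a) x' ∧ b = hide I a ∧ s = x'.map (.abstr I) := by
  constructor
  · intro h; cases h <;> exact ⟨_, _, ‹_›, by simp [hide, *], rfl⟩
  · rintro ⟨a, x', h, rfl, rfl⟩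
    by_cases ha : a.In I
    · simp only [hide, ha, if_true]
      cases x' with
      | none => exact .abstr_hide_term h ha
      | some x' => exact .abstr_hide h ha
    · simp only [hide, ha, if_false]
      cases x' with
      | none => exact .abstr_term h ha
      | some x' => exact .abstr h ha

@[simp] theorem tr_abstr_sigma (I) (x : Term A) (s) :
    Tr γ (.abstr I x) .sigma s ↔ ∃ x', Tr γ x .sigma (some x') ∧ s = some (.abstr I x') := by
  constructor
  · intro h; cases h; exact ⟨_, ‹_›, rfl⟩
  · rintro ⟨x', h, rfl⟩; exact .abstr_idle h

@[simp] theorem tr_timeout_act (x : Term A) (a s) :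
    Tr γ (.timeout x) (.act a) s ↔ Tr γ x (.act a) s :=
  ⟨fun h => by cases h; assumption, .timeout⟩

@[simp] theorem tr_timeout_sigma (x : Term A) (s) : ¬ Tr γ (.timeout x) .sigma s := nofun

@[simp] theorem tr_fix (V : Set ℕ) (E : V → Term A) (X : V) (α s) :
    Tr γ (.fix V E X) α s ↔ Tr γ (Term.close V E (E X)) α s :=
  ⟨fun h => by cases h; assumption, .fix⟩

/-! ### Idling -/

/-- A derivation of a σ-transition is itself an evaluation: the negative premises of `Tr` are the
very hypotheses that `IdleVal.alt` asks for. Together with `IdleVal.exists_tr` it identifies the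
value `true` with having a σ-transition. Absence of a σ-transition, on the other hand, means `false`
or undecided. -/
theorem Tr.idleVal {t : Term A} {α s} (h : Tr γ t α s) : α = .sigma → IdleVal t true := by
  induction h with
  | alt_idle_left _ h ih => intro e; exact .alt (ih e) h
  | alt_idle_right h _ ih => intro e; exact .alt h (ih e)
  | alt_idle _ _ ih ih' => intro e; exact .alt (ih e) (ih' e)
  | par_idle _ _ ih ih' => intro e; exact .par (ih e) (ih' e)
  | lmerge_idle _ _ ih ih' => intro e; exact .lmerge (ih e) (ih' e)
  | cmerge_idle _ _ ih ih' => intro e; exact .cmerge (ih e) (ih' e)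
  | delay x => intro _; exact .delay x
  | _ => simp_all

theorem IdleVal.not_tr {t : Term A} (h : IdleVal t false) (s) : ¬ Tr γ t .sigma s :=
  fun h' => h.not_true_of_false (h'.idleVal rfl)

theorem Tr.not_idleVal {t : Term A} {s} (h : Tr γ t .sigma s) : ¬ IdleVal t false :=
  fun h' => h'.not_tr s h

theorem IdleVal.exists_tr {t : Term A} {b} (h : IdleVal t b) :
    b = true → ∃ s, Tr γ t .sigma (some s) := by
  induction h with
  | @alt x y b c h₁ h₂ ih₁ ih₂ =>
    intro e
    cases b <;> cases c
    · cases e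
    · obtain ⟨s, hs⟩ := ih₂ rfl
      exact ⟨s, by simp [*]⟩
    · obtain ⟨s, hs⟩ := ih₁ rfl
      exact ⟨s, by simp [*]⟩
    · obtain ⟨s, hs⟩ := ih₁ rfl
      obtain ⟨s', hs'⟩ := ih₂ rfl
      exact ⟨s ⊹ s', by simp [*]⟩
  | par _ _ ih₁ ih₂ | lmerge _ _ ih₁ ih₂ | cmerge _ _ ih₁ ih₂ =>
    intro e
    obtain ⟨s, hs⟩ := ih₁ rfl
    obtain ⟨s', hs'⟩ := ih₂ rfl
    simp only [tr_par_sigma, tr_lmerge_sigma, tr_cmerge_sigma]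
    exact ⟨_, _, _, hs, hs', rfl⟩
  | seq _ ih | encap _ ih | abstr _ ih | fix _ ih =>
    intro e
    obtain ⟨s, hs⟩ := ih e
    simp only [tr_seq, tr_encap_sigma, tr_abstr_sigma, tr_fix]
    first | exact ⟨_, _, hs, rfl⟩ | exact ⟨_, hs⟩
  | _ => simp

/-- Time determinism. -/
theorem Tr.sigma_unique {t : Term A} {α s s'} (h : Tr γ t α s) (h' : Tr γ t α s') :
    α = .sigma → s = s' := by
  induction h generalizing s' with
  | alt_idle_left h₁ h₂ ih =>
    rintro -
    -- The other two rules for choice are excluded because an operand of value `false` has no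
    -- σ-transition.
    rcases (tr_alt_sigma ..).1 h' with ⟨h, -⟩ | ⟨h, -⟩ | ⟨x', y', -, h, -⟩
    exacts [ih h rfl, (h.not_tr _ h₁).elim, (h₂.not_tr _ h).elim]
  | alt_idle_right h₁ h₂ ih =>
    rintro -
    rcases (tr_alt_sigma ..).1 h' with ⟨-, h⟩ | ⟨-, h⟩ | ⟨x', y', h, -, -⟩
    exacts [(h.not_tr _ h₂).elim, ih h rfl, (h₁.not_tr _ h).elim]
  | alt_idle h₁ h₂ ih₁ ih₂ =>
    rintro -
    rcases (tr_alt_sigma ..).1 h' with ⟨-, h⟩ | ⟨h, -⟩ | ⟨x', y', h, k, rfl⟩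
    · exact (h.not_tr _ h₂).elim
    · exact (h.not_tr _ h₁).elim
    · cases ih₁ h rfl; cases ih₂ k rfl; rfl
  | par_idle _ _ ih₁ ih₂ | lmerge_idle _ _ ih₁ ih₂ | cmerge_idle _ _ ih₁ ih₂ =>
    rintro -
    simp only [tr_par_sigma, tr_lmerge_sigma, tr_cmerge_sigma] at h'
    obtain ⟨x', y', h, k, rfl⟩ := h'
    cases ih₁ h rfl; cases ih₂ k rfl; rfl
  | seq_idle _ ih | encap_idle _ ih | abstr_idle _ ih =>
    rintro -
    simp only [tr_seq, tr_encap_sigma, tr_abstr_sigma] at h'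
    obtain ⟨x', h, rfl⟩ := h'
    cases ih h rfl; rfl
  | delay x => rintro -; simp_all
  | fix _ ih => exact ih ((tr_fix ..).1 h')
  | _ => simp

/-! ### Branching bisimilarity -/

@[simp] theorem trans_some (T : Term A → Label A → Option (Term A) → Prop) (t α s) :
    Trans T (some t) α s ↔ T t α s := Iff.rfl

@[simp] theorem trans_none (T : Term A → Label A → Option (Term A) → Prop) (α s) :
    ¬ Trans T none α s := id

theorem Silent.mono {T : Term A → Label A → Option (Term A) → Prop} {R R' p p' q r}
    (h : Silent T R p q r) (hR : ∀ v, R p v → R' p' v) : Silent T R' p' q r :=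
  Relation.ReflTransGen.mono (fun _ _ h => ⟨h.1, hR _ h.2⟩) _ _ h

theorem Silent.lift {T : Term A → Label A → Option (Term A) → Prop} {R R' p p' q r}
    (f : Option (Term A) → Option (Term A)) (h : Silent T R p q r)
    (hf : ∀ u v, Trans T u (.act .tau) v → Trans T (f u) (.act .tau) (f v))
    (hR : ∀ v, R p v → R' p' (f v)) : Silent T R' p' (f q) (f r) :=
  Relation.ReflTransGen.lift f (fun _ _ h => ⟨hf _ _ h.1, hR _ h.2⟩) _ _ h

theorem Silent.rel {T : Term A → Label A → Option (Term A) → Prop} {R p q r}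
    (h : Silent T R p q r) (h₀ : R p q) : R p r := by
  cases h with
  | refl => exact h₀
  | tail _ h => exact h.2

/-- `TransferTo T R R'` is the transfer condition on `R`, with the targets related by `R'`. -/
def TransferTo (T : Term A → Label A → Option (Term A) → Prop)
    (R R' : Option (Term A) → Option (Term A) → Prop) : Prop :=
  ∀ p q, R p q →
    (∀ α p', Trans T p α p' →
      (α = .act .tau ∧ R' p' q) ∨
        ∃ r q', Silent T R p q r ∧ Trans T r α q' ∧ R' p' q') ∧
    (p = none → Silent T R p q none)

/-- Silent steps are matched within `R`. -/
def MatchesSilent (T : Term A → Label A → Option (Term A) → Prop)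
    (R : Option (Term A) → Option (Term A) → Prop) : Prop :=
  ∀ p q p', R p q → Trans T p (.act .tau) p' →
    R p' q ∨ ∃ r q', Silent T R p q r ∧ Trans T r (.act .tau) q' ∧ R p' q'

/-- A silent path can itself serve as the answer to one silent step: if it is empty, the answer is
to stand still; otherwise its last step is the answer and the rest is the preparation. -/
theorem Silent.absorb {T : Term A → Label A → Option (Term A) → Prop} {R p q r}
    {S : Option (Term A) → Prop} (h : Silent T R p q r) (hS : S r) :
    S q ∨ ∃ w q', Silent T R p q w ∧ Trans T w (.act .tau) q' ∧ S q' := by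
  cases h with
  | refl => exact .inl hS
  | tail h₁ h₂ => exact .inr ⟨_, _, h₁, h₂.1, hS⟩

theorem Transfer.matchesSilent {T : Term A → Label A → Option (Term A) → Prop} {R}
    (h : Transfer T R) : MatchesSilent T R := fun p q _ hpq hp =>
  ((h p q hpq).1 _ _ hp).imp And.right id

-- The path is mirrored one step at a time, which requires the mirrored states to stay in `R₂`. An
-- intermediate state of the mirror is related to `p` through the path state that it shadows.
open Relation in
theorem Silent.comp {T : Term A → Label A → Option (Term A) → Prop} {R₁ R₂ p q r s}
    (h : Silent T R₁ p q r) (h₂ : MatchesSilent T R₂) (hpq : R₁ p q) (hqs : R₂ q s) :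
    ∃ s', Silent T (Comp R₁ R₂) p s s' ∧ R₂ r s' := by
  induction h with
  | refl => exact ⟨s, .refl, hqs⟩
  | @tail r r' h hr ih =>
    obtain ⟨s', hs, hrs⟩ := ih
    have hpr : R₁ p r := Silent.rel h hpq
    rcases h₂ _ _ _ hrs hr.1 with h' | ⟨w, b, hw, hb, hrb⟩
    · exact ⟨s', hs, h'⟩
    · exact ⟨b, (hs.trans (Silent.mono hw fun v hv => ⟨r, hpr, hv⟩)).tail
        ⟨hb, r', hr.2, hrb⟩, hrb⟩

-- The target relations may be larger than the source relations, but a silent path must be mirrored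
-- within the source relation; this is why `MatchesSilent` is demanded separately. With equal
-- sources and targets it gives transitivity of `BB`; in `Ctx.bb` the source is the guarded contexts
-- and the target all contexts.
open Relation in
theorem TransferTo.comp {T : Term A → Label A → Option (Term A) → Prop} {R₁ R₁' R₂ R₂'}
    (h₁ : TransferTo T R₁ R₁') (h₂ : TransferTo T R₂ R₂') (hm : MatchesSilent T R₂)
    (hle : ∀ p q, R₂ p q → R₂' p q) : TransferTo T (Comp R₁ R₂) (Comp R₁' R₂') := by
  rintro p s ⟨q, hpq, hqs⟩
  refine ⟨fun α p' hp => ?_, ?_⟩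
  · rcases (h₁ p q hpq).1 _ _ hp with ⟨rfl, h⟩ | ⟨r, q', hr, hq', hpq'⟩
    · exact .inl ⟨rfl, q, h, hle _ _ hqs⟩
    · obtain ⟨s', hs, hrs⟩ := hr.comp hm hpq hqs
      have hpr : R₁ p r := hr.rel hpq
      rcases (h₂ r s' hrs).1 _ _ hq' with ⟨rfl, h⟩ | ⟨w, b, hw, hb, hqb⟩
      -- The step of `r` is silent and `s'` answers by standing still, so the answer of `s` is the
      -- path to `s'` already travelled.
      · exact (hs.absorb (S := Comp R₁' R₂' p') ⟨q', hpq', h⟩).imp (fun h => ⟨rfl, h⟩) id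
      · exact .inr ⟨w, b, hs.trans (hw.mono fun v hv => ⟨r, hpr, hv⟩), hb, q', hpq', hqb⟩
  · rintro rfl
    obtain ⟨s', hs, hrs⟩ := ((h₁ _ q hpq).2 rfl).comp hm hpq hqs
    have hpr : R₁ none none := ((h₁ _ q hpq).2 rfl).rel hpq
    exact hs.trans (((h₂ _ _ hrs).2 rfl).mono fun v hv => ⟨none, hpr, hv⟩)

/-- Branching bisimilarity with respect to the transition relation `Tr γ`. -/
def BB (γ : Acttd A → Acttd A → Acttd A) (p q : Option (Term A)) : Prop :=
  ∃ R, (∀ p q, R p q → R q p) ∧ Transfer (Tr γ) R ∧ R p q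

theorem BB.symm {p q : Option (Term A)} : BB γ p q → BB γ q p :=
  fun ⟨R, hs, ht, h⟩ => ⟨R, hs, ht, hs _ _ h⟩

theorem BB.transfer : Transfer (Tr γ) (BB γ : Option (Term A) → _) := by
  rintro p q ⟨R, hs, ht, h⟩
  refine ⟨fun α p' hp => ?_, fun hp => ((ht p q h).2 hp).mono fun v hv => ⟨R, hs, ht, hv⟩⟩
  refine ((ht p q h).1 _ _ hp).imp (And.imp_right fun h => ⟨R, hs, ht, h⟩) ?_
  rintro ⟨r, q', hr, hq, h'⟩
  exact ⟨r, q', hr.mono fun v hv => ⟨R, hs, ht, hv⟩, hq, R, hs, ht, h'⟩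

theorem BB.refl (p : Option (Term A)) : BB γ p p := by
  refine ⟨Eq, fun _ _ => Eq.symm, ?_, rfl⟩
  rintro p _ rfl
  exact ⟨fun α p' hp => .inr ⟨p, p', .refl, hp, rfl⟩, fun h => h ▸ .refl⟩

/-- A relation whose union with its converse is a branching bisimulation. -/
theorem BB.of_transfer {R : Option (Term A) → Option (Term A) → Prop}
    (h : Transfer (Tr γ) R) (h' : Transfer (Tr γ) (flip R)) {p q} (hpq : R p q) : BB γ p q := by
  refine ⟨fun p q => R p q ∨ R q p, fun _ _ => Or.symm, ?_, .inl hpq⟩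
  rintro p q (hpq | hpq)
  · refine ⟨fun α p' hp => ?_, fun hp => ((h p q hpq).2 hp).mono fun v hv => .inl hv⟩
    refine ((h p q hpq).1 _ _ hp).imp (And.imp_right .inl) ?_
    rintro ⟨r, q', hr, hq, h'⟩
    exact ⟨r, q', hr.mono fun v hv => .inl hv, hq, .inl h'⟩
  · refine ⟨fun α p' hp => ?_, fun hp => ((h' p q hpq).2 hp).mono fun v hv => .inr hv⟩
    refine ((h' p q hpq).1 _ _ hp).imp (And.imp_right .inr) ?_
    rintro ⟨r, q', hr, hq, h'⟩
    exact ⟨r, q', hr.mono fun v hv => .inr hv, hq, .inr h'⟩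

theorem BB.trans {p q r : Option (Term A)} (h₁ : BB γ p q) (h₂ : BB γ q r) : BB γ p r := by
  have ht : Transfer (Tr γ) (Relation.Comp (BB γ) (BB γ) : Option (Term A) → _) :=
    TransferTo.comp BB.transfer BB.transfer BB.transfer.matchesSilent fun _ _ => id
  refine ⟨_, ?_, ht, q, h₁, h₂⟩
  rintro p q ⟨r, h, h'⟩
  exact ⟨r, h'.symm, h.symm⟩

/-- A symmetric relation in which every transition is matched by a single one. -/
theorem BB.of_strong {R : Option (Term A) → Option (Term A) → Prop}
    (hs : ∀ p q, R p q → R q p) (hn : ∀ q, R none q → q = none)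
    (h : ∀ s t, R (some s) (some t) → ∀ α s', Tr γ s α s' → ∃ t', Tr γ t α t' ∧ R s' t')
    {p q} (hpq : R p q) : BB γ p q := by
  refine ⟨R, hs, ?_, hpq⟩
  rintro (_ | s) q hpq
  · cases hn _ hpq
    exact ⟨fun _ _ h => h.elim, fun _ => .refl⟩
  · rcases q with _ | t
    · cases hn _ (hs _ _ hpq)
    · refine ⟨fun α p' hp => ?_, nofun⟩
      obtain ⟨t', ht, h'⟩ := h s t hpq α p' hp
      exact .inr ⟨_, _, .refl, ht, h'⟩

/-- Terms are branching bisimilar if their transitions are matched up to bisimilarity. -/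
theorem BB.of_match {s t : Term A}
    (h : ∀ α s', Tr γ s α s' → ∃ t', Tr γ t α t' ∧ BB γ s' t')
    (h' : ∀ α t', Tr γ t α t' → ∃ s', Tr γ s α s' ∧ BB γ s' t') : BB γ (some s) (some t) := by
  have key : ∀ s t : Term A, (∀ α s', Tr γ s α s' → ∃ t', Tr γ t α t' ∧ BB γ s' t') →
      Transfer (Tr γ) (fun p q => BB γ p q ∨ (p = some s ∧ q = some t)) := by
    rintro s t h p q (h | ⟨rfl, rfl⟩)
    · refine ⟨fun α p' hp => ?_, fun hp => ((BB.transfer p q h).2 hp).mono fun v hv => .inl hv⟩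
      refine ((BB.transfer p q h).1 _ _ hp).imp (And.imp_right .inl) ?_
      rintro ⟨r, q', hr, hq, h'⟩
      exact ⟨r, q', hr.mono fun v hv => .inl hv, hq, .inl h'⟩
    · refine ⟨fun α p' hp => ?_, nofun⟩
      obtain ⟨t', ht, hb⟩ := h α p' hp
      exact .inr ⟨_, _, .refl, ht, .inl hb⟩
  refine BB.of_transfer (key s t h) ?_ (.inr ⟨rfl, rfl⟩)
  have e : flip (fun p q => BB γ p q ∨ (p = some s ∧ q = some t)) =
      fun p q => BB γ p q ∨ (p = some t ∧ q = some s) := by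
    funext p q
    simp only [flip, and_comm, eq_iff_iff]
    exact or_congr_left ⟨BB.symm, BB.symm⟩
  rw [e]
  exact key t s fun α t' ht => (h' α t' ht).imp fun _ => And.imp_right BB.symm

/-- The law that underlies the branching axioms: a term that silently moves to `q`, and whose
other transitions are also transitions of `q`, is branching bisimilar to `q`. -/
theorem BB.of_silent {s : Term A} {q : Option (Term A)} (h₀ : Tr γ s (.act .tau) q)
    (h : ∀ α s', Tr γ s α s' → (α = .act .tau ∧ s' = q) ∨ Trans (Tr γ) q α s') :
    BB γ (some s) q := by
  refine BB.of_transfer (R := fun p r => p = r ∨ (p = some s ∧ r = q)) ?_ ?_ (.inr ⟨rfl, rfl⟩)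
  · rintro p r (rfl | ⟨rfl, rfl⟩)
    · exact ⟨fun α p' hp => .inr ⟨_, _, .refl, hp, .inl rfl⟩, fun hp => hp ▸ .refl⟩
    · refine ⟨fun α p' hp => ?_, nofun⟩
      rcases h α p' hp with ⟨rfl, rfl⟩ | h
      · exact .inl ⟨rfl, .inl rfl⟩
      · exact .inr ⟨_, _, .refl, h, .inl rfl⟩
  · rintro p r (rfl | ⟨rfl, rfl⟩)
    · exact ⟨fun α p' hp => .inr ⟨_, _, .refl, hp, .inl rfl⟩, fun hp => hp ▸ .refl⟩
    · refine ⟨fun α p' hp => .inr ⟨_, _, .single ⟨h₀, .inl rfl⟩, hp, .inl rfl⟩, ?_⟩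
      rintro rfl
      exact .single ⟨h₀, .inl rfl⟩

/-! ### Branching bisimilarity is a congruence for sequencing, merge and the renamings -/

theorem Trans.seqO {p p' : Option (Term A)} {α} (h : Trans (Tr γ) p α p') (y : Term A) :
    Trans (Tr γ) (some (seqO p y)) α (some (seqO p' y)) := by
  cases p with
  | none => exact h.elim
  | some x => simpa using ⟨p', h, rfl⟩

/-- The candidate relation must also contain `BB` itself, because nothing of the first operand is
left once it has terminated. If only one side has terminated, the other catches up silently, by the
termination clause of the transfer condition. -/
theorem BB.seqO {p q : Option (Term A)} {y z : Term A} (h : BB γ p q)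
    (h' : BB γ (some y) (some z)) : BB γ (some (seqO p y)) (some (seqO q z)) := by
  set R : Option (Term A) → Option (Term A) → Prop := fun u v => BB γ u v ∨
    ∃ p q y z, BB γ p q ∧ BB γ (some y) (some z) ∧ u = some (DRT.seqO p y) ∧
      v = some (DRT.seqO q z) with hR
  refine ⟨R, ?_, ?_, .inr ⟨p, q, y, z, h, h', rfl, rfl⟩⟩
  · rintro p q (h | ⟨p, q, y, z, h, h', rfl, rfl⟩)
    · exact .inl h.symm
    · exact .inr ⟨_, _, _, _, h.symm, h'.symm, rfl, rfl⟩
  clear h h'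
  rintro u v (h | ⟨p, q, y, z, h, h', rfl, rfl⟩)
  · refine ⟨fun α p' hp => ?_, fun hp => ((BB.transfer u v h).2 hp).mono fun v hv => .inl hv⟩
    refine ((BB.transfer u v h).1 _ _ hp).imp (And.imp_right .inl) ?_
    rintro ⟨r, q', hr, hq, h'⟩
    exact ⟨r, q', hr.mono fun v hv => .inl hv, hq, .inl h'⟩
  refine ⟨fun α s hs => ?_, nofun⟩
  have lift : ∀ {r}, Silent (Tr γ) (BB γ) p q r →
      Silent (Tr γ) R (some (DRT.seqO p y)) (some (DRT.seqO q z)) (some (DRT.seqO r z)) :=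
    fun hr => hr.lift (fun v => some (DRT.seqO v z)) (fun _ _ h => h.seqO z)
      fun v hv => .inr ⟨_, _, _, _, hv, h', rfl, rfl⟩
  rcases p with _ | x
  -- Here the left side is already running `y`, while `q` may still have to reach √ silently before
  -- `z` can answer.
  · have hq := lift ((BB.transfer _ _ h).2 rfl)
    rcases (BB.transfer _ _ h').1 _ _ hs with ⟨rfl, hz⟩ | ⟨r, s', hr, hs', hb⟩
    · exact (hq.absorb (S := R s) (.inl hz)).imp (fun h => ⟨rfl, h⟩) id
    · exact .inr ⟨r, s', hq.trans (hr.mono fun v hv => .inl hv), hs', .inl hb⟩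
  · obtain ⟨x', hx, rfl⟩ := (tr_seq ..).1 hs
    rcases (BB.transfer _ _ h).1 _ _ hx with ⟨rfl, hz⟩ | ⟨r, s', hr, hs', hb⟩
    · exact .inl ⟨rfl, .inr ⟨_, _, _, _, hz, h', rfl, rfl⟩⟩
    · exact .inr ⟨_, _, lift hr, hs'.seqO z, .inr ⟨_, _, _, _, hb, h', rfl, rfl⟩⟩

theorem Trans.parO_left {p p' : Option (Term A)} {a} (h : Trans (Tr γ) p (.act a) p')
    (q : Option (Term A)) : Trans (Tr γ) (parO p q) (.act a) (parO p' q) := by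
  cases p with
  | none => exact h.elim
  | some x =>
    cases q with
    | none => simpa using h
    | some y => exact (tr_par_act ..).2 (.inl ⟨p', h, rfl⟩)

theorem Trans.parO_right {q q' : Option (Term A)} {a} (h : Trans (Tr γ) q (.act a) q')
    (p : Option (Term A)) : Trans (Tr γ) (parO p q) (.act a) (parO p q') := by
  cases q with
  | none => exact h.elim
  | some x =>
    cases p with
    | none => simpa using h
    | some y => exact (tr_par_act ..).2 (.inr (.inl ⟨q', h, rfl⟩))

theorem Trans.parO_comm {p p' q q' : Option (Term A)} {a b c}
    (h : Trans (Tr γ) p (.act a) p') (h' : Trans (Tr γ) q (.act b) q')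
    (e : γ (.ofActt a) (.ofActt b) = .ofActt c) :
    Trans (Tr γ) (parO p q) (.act c) (parO p' q') := by
  cases p with
  | none => exact h.elim
  | some x =>
    cases q with
    | none => exact h'.elim
    | some y => exact (tr_par_act ..).2 (.inr (.inr ⟨a, b, p', q', h, h', e, rfl⟩))

theorem Trans.parO_sigma {p p' q q' : Option (Term A)}
    (h : Trans (Tr γ) p .sigma p') (h' : Trans (Tr γ) q .sigma q') :
    Trans (Tr γ) (parO p q) .sigma (parO p' q') := by
  cases p with
  | none => exact h.elim
  | some x =>
    cases q with
    | none => exact h'.elim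
    | some y =>
      obtain ⟨x', rfl⟩ := Step.sigma_isSome h rfl
      obtain ⟨y', rfl⟩ := Step.sigma_isSome h' rfl
      exact (tr_par_sigma ..).2 ⟨_, _, h, h', rfl⟩

theorem Trans.parO_cases {p q s : Option (Term A)} {α} (h : Trans (Tr γ) (parO p q) α s) :
    (∃ a p', α = .act a ∧ Trans (Tr γ) p α p' ∧ s = parO p' q) ∨
    (∃ a q', α = .act a ∧ Trans (Tr γ) q α q' ∧ s = parO p q') ∨
    (∃ a b c p' q', α = .act c ∧ Trans (Tr γ) p (.act a) p' ∧ Trans (Tr γ) q (.act b) q' ∧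
      γ (.ofActt a) (.ofActt b) = .ofActt c ∧ s = parO p' q') ∨
    (α = .sigma ∧ p = none ∧ Trans (Tr γ) q .sigma s) ∨
    (α = .sigma ∧ q = none ∧ Trans (Tr γ) p .sigma s) ∨
    (∃ p' q', α = .sigma ∧ Trans (Tr γ) p .sigma p' ∧ Trans (Tr γ) q .sigma q' ∧
      s = parO p' q') := by
  rcases p with _ | x
  · cases α with
    | act a => exact .inr (.inl ⟨a, s, rfl, h, rfl⟩)
    | sigma => exact .inr (.inr (.inr (.inl ⟨rfl, rfl, h⟩)))
  rcases q with _ | y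
  · cases α with
    | act a => exact .inl ⟨a, s, rfl, h, by simp⟩
    | sigma => exact .inr (.inr (.inr (.inr (.inl ⟨rfl, rfl, h⟩))))
  cases α with
  | act c =>
    rcases (tr_par_act ..).1 h with ⟨x', k, rfl⟩ | ⟨y', k, rfl⟩ | ⟨a, b, x', y', k, k', e, rfl⟩
    · exact .inl ⟨c, x', rfl, k, rfl⟩
    · exact .inr (.inl ⟨c, y', rfl, k, rfl⟩)
    · exact .inr (.inr (.inl ⟨a, b, c, x', y', rfl, k, k', e, rfl⟩))
  | sigma =>
    obtain ⟨x', y', k, k', rfl⟩ := (tr_par_sigma ..).1 h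
    exact .inr (.inr (.inr (.inr (.inr ⟨some x', some y', rfl, k, k', rfl⟩))))

/-- The conditions on the communication function, except for associativity. -/
structure CommTau (γ : Acttd A → Acttd A → Acttd A) : Prop where
  comm : ∀ a b, γ a b = γ b a
  tau : ∀ a, γ .tau a = .dead
  dead : ∀ a, γ .dead a = .dead
  basic : ∀ a b : A, γ (.basic a) (.basic b) ≠ .tau

theorem CommTau.ne_left (hγ : CommTau γ) {a b c : Actt A}
    (e : γ (.ofActt a) (.ofActt b) = .ofActt c) : a ≠ .tau := by
  rintro rfl
  cases (hγ.tau _).symm.trans e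

theorem CommTau.ne_right (hγ : CommTau γ) {a b c : Actt A}
    (e : γ (.ofActt a) (.ofActt b) = .ofActt c) : b ≠ .tau :=
  hγ.ne_left ((hγ.comm _ _).trans e)

/-- τ does not communicate, so both partners are basic actions, and for these τ is ruled out as a
result. Hence synchronisation never creates a silent step, on which the treatment of guarded
contexts rests. -/
theorem CommTau.ne (hγ : CommTau γ) {a b c : Actt A}
    (e : γ (.ofActt a) (.ofActt b) = .ofActt c) : c ≠ .tau := by
  rintro rfl
  have ha := hγ.ne_left e
  have hb := hγ.ne_right e
  cases a <;> cases b <;> first | contradiction | exact hγ.basic _ _ e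

/-- Since √ is a unit for `parO`, the candidate relation already contains `BB`. The silent
preparations of the two components are interleaved one after the other, the first component going
first. -/
theorem BB.parO (hγ : CommTau γ) {p p' q q' : Option (Term A)} (h : BB γ p q)
    (h' : BB γ p' q') : BB γ (parO p p') (parO q q') := by
  set R : Option (Term A) → Option (Term A) → Prop := fun u v =>
    ∃ p q p' q', BB γ p q ∧ BB γ p' q' ∧ u = DRT.parO p p' ∧ v = DRT.parO q q' with hR
  refine ⟨R, ?_, ?_, ⟨p, q, p', q', h, h', rfl, rfl⟩⟩
  · rintro p q ⟨p, q, y, z, h, h', rfl, rfl⟩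
    exact ⟨_, _, _, _, h.symm, h'.symm, rfl, rfl⟩
  clear h h'
  rintro u v ⟨p, q, p', q', h, h', rfl, rfl⟩
  have lift₁ : ∀ {r}, Silent (Tr γ) (BB γ) p q r →
      Silent (Tr γ) R (DRT.parO p p') (DRT.parO q q') (DRT.parO r q') :=
    fun hr => hr.lift (fun v => DRT.parO v q') (fun _ _ h => h.parO_left q')
      fun v hv => ⟨_, _, _, _, hv, h', rfl, rfl⟩
  have lift₂ : ∀ {r r'}, BB γ p r → Silent (Tr γ) (BB γ) p' q' r' →
      Silent (Tr γ) R (DRT.parO p p') (DRT.parO r q') (DRT.parO r r') :=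
    fun {r _} hpr hr => hr.lift (fun v => DRT.parO r v) (fun _ _ h => h.parO_right r)
      fun v hv => ⟨_, _, _, _, hpr, hv, rfl, rfl⟩
  refine ⟨fun α s hs => ?_, fun hp => ?_⟩
  · rcases hs.parO_cases with ⟨a, s, rfl, ks, rfl⟩ | ⟨a, s, rfl, ks, rfl⟩ |
      ⟨a, b, c, s, s', rfl, ks, ks', e, rfl⟩ | ⟨rfl, rfl, ks⟩ | ⟨rfl, rfl, ks⟩ |
      ⟨s, s', rfl, ks, ks', rfl⟩
    · rcases (BB.transfer _ _ h).1 _ _ ks with ⟨ha, hb⟩ | ⟨r, t, hr, ht, hb⟩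
      · exact .inl ⟨ha, _, _, _, _, hb, h', rfl, rfl⟩
      · exact .inr ⟨_, _, lift₁ hr, ht.parO_left q', _, _, _, _, hb, h', rfl, rfl⟩
    · rcases (BB.transfer _ _ h').1 _ _ ks with ⟨ha, hb⟩ | ⟨r, t, hr, ht, hb⟩
      · exact .inl ⟨ha, _, _, _, _, h, hb, rfl, rfl⟩
      · exact .inr ⟨_, _, lift₂ h hr, ht.parO_right q, _, _, _, _, h, hb, rfl, rfl⟩
    · rcases (BB.transfer _ _ h).1 _ _ ks with ⟨ha, hb⟩ | ⟨r, t, hr, ht, hb⟩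
      -- Only a silent step may be answered by standing still, and a partner in a communication is
      -- never silent.
      · cases ha; cases hγ.ne_left e rfl
      rcases (BB.transfer _ _ h').1 _ _ ks' with ⟨ha, hb⟩ | ⟨r', t', hr', ht', hb'⟩
      · cases ha; cases hγ.ne_right e rfl
      exact .inr ⟨_, _, (lift₁ hr).trans (lift₂ (hr.rel h) hr'), ht.parO_comm ht' e,
        _, _, _, _, hb, hb', rfl, rfl⟩
    -- Beside √ the other component idles freely, whereas a live component would have to idle along.
    -- So `q` is first driven silently to √.
    · have hn := (BB.transfer _ _ h).2 rfl
      rcases (BB.transfer _ _ h').1 _ _ ks with ⟨ha, hb⟩ | ⟨r, t, hr, ht, hb⟩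
      · cases ha
      exact .inr ⟨r, t, (lift₁ hn).trans (lift₂ (BB.refl _) hr), ht,
        none, none, _, _, BB.refl _, hb, rfl, rfl⟩
    · have hn := (BB.transfer _ _ h').2 rfl
      rcases (BB.transfer _ _ h).1 _ _ ks with ⟨ha, hb⟩ | ⟨r, t, hr, ht, hb⟩
      · cases ha
      exact .inr ⟨DRT.parO r none, t, (lift₁ hr).trans (lift₂ (hr.rel h) hn), by simpa using ht,
        _, _, none, none, hb, BB.refl _, by simp, by simp⟩
    · rcases (BB.transfer _ _ h).1 _ _ ks with ⟨ha, hb⟩ | ⟨r, t, hr, ht, hb⟩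
      · cases ha
      rcases (BB.transfer _ _ h').1 _ _ ks' with ⟨ha, hb⟩ | ⟨r', t', hr', ht', hb'⟩
      · cases ha
      exact .inr ⟨_, _, (lift₁ hr).trans (lift₂ (hr.rel h) hr'), ht.parO_sigma ht',
        _, _, _, _, hb, hb', rfl, rfl⟩
  · obtain ⟨rfl, rfl⟩ : p = none ∧ p' = none := by cases p <;> cases p' <;> simp_all
    exact (lift₁ ((BB.transfer _ _ h).2 rfl)).trans
      (lift₂ (BB.refl _) ((BB.transfer _ _ h').2 rfl))

/-- Congruence for a unary operator that renames visible actions or blocks them. -/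
theorem BB.map {f : Term A → Term A} {g : Label A → Label A → Prop}
    (hf : ∀ x α s, Tr γ (f x) α s ↔ ∃ β x', Tr γ x β x' ∧ g β α ∧ s = x'.map f)
    (hg : ∀ α, g (.act .tau) α ↔ α = .act .tau) {p q : Option (Term A)} (h : BB γ p q) :
    BB γ (p.map f) (q.map f) := by
  have lift_trans : ∀ {p p' : Option (Term A)} {α β}, Trans (Tr γ) p α p' → g α β →
      Trans (Tr γ) (p.map f) β (p'.map f) := by
    rintro (_ | x) p' α β h hg
    · exact h.elim
    · exact (hf ..).2 ⟨α, p', h, hg, rfl⟩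
  set R : Option (Term A) → Option (Term A) → Prop := fun u v =>
    ∃ p q, BB γ p q ∧ u = p.map f ∧ v = q.map f with hR
  refine ⟨R, ?_, ?_, p, q, h, rfl, rfl⟩
  · rintro p q ⟨p, q, h, rfl, rfl⟩
    exact ⟨_, _, h.symm, rfl, rfl⟩
  clear h
  rintro u v ⟨p, q, h, rfl, rfl⟩
  have lift : ∀ {r}, Silent (Tr γ) (BB γ) p q r →
      Silent (Tr γ) R (p.map f) (q.map f) (r.map f) :=
    fun hr => hr.lift (Option.map f) (fun _ _ h => lift_trans h ((hg _).2 rfl))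
      fun v hv => ⟨_, _, hv, rfl, rfl⟩
  refine ⟨fun α s hs => ?_, fun hp => ?_⟩
  · rcases p with _ | x
    · exact hs.elim
    obtain ⟨β, x', hx, hβ, rfl⟩ := (hf ..).1 hs
    rcases (BB.transfer _ _ h).1 _ _ hx with ⟨rfl, hb⟩ | ⟨r, t, hr, ht, hb⟩
    · exact .inl ⟨(hg _).1 hβ, _, _, hb, rfl, rfl⟩
    · exact .inr ⟨_, _, lift hr, lift_trans ht hβ, _, _, hb, rfl, rfl⟩
  · rw [Option.map_eq_none_iff] at hp
    subst hp
    exact lift ((BB.transfer _ _ h).2 rfl)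

@[simp] theorem not_tau_in (H : Set A) : ¬ (Actt.tau : Actt A).In H := by simp [Actt.In]

theorem BB.encap (H : Set A) {p q : Option (Term A)} (h : BB γ p q) :
    BB γ (p.map (.encap H)) (q.map (.encap H)) := by
  refine BB.map (g := fun β α => β = α ∧ ∀ a, β = .act a → ¬ a.In H) ?_ (fun α => ?_) h
  · rintro x (a | _) s
    · simp only [tr_encap_act]
      grind
    · rw [tr_encap_sigma]
      constructor
      · rintro ⟨x', h, rfl⟩; exact ⟨_, _, h, ⟨rfl, nofun⟩, rfl⟩
      · rintro ⟨_, x', h, ⟨rfl, -⟩, rfl⟩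
        obtain ⟨x', rfl⟩ := Step.sigma_isSome h rfl
        exact ⟨_, h, rfl⟩
  · refine ⟨fun h => h.1.symm, ?_⟩
    rintro rfl
    refine ⟨rfl, ?_⟩
    rintro _ ⟨⟩
    exact not_tau_in H

theorem BB.abstr (I : Set A) {p q : Option (Term A)} (h : BB γ p q) :
    BB γ (p.map (.abstr I)) (q.map (.abstr I)) := by
  refine BB.map (g := fun β α => (β = .sigma ∧ α = .sigma) ∨
    ∃ a, β = .act a ∧ α = .act (hide I a)) ?_ (fun α => ?_) h
  · rintro x (a | _) s
    · simp only [tr_abstr_act]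
      grind
    · rw [tr_abstr_sigma]
      constructor
      · rintro ⟨x', h, rfl⟩; exact ⟨_, _, h, .inl ⟨rfl, rfl⟩, rfl⟩
      · rintro ⟨_, x', h, ⟨rfl, -⟩ | ⟨a, rfl, ⟨⟩⟩, rfl⟩
        obtain ⟨x', rfl⟩ := Step.sigma_isSome h rfl
        exact ⟨_, h, rfl⟩
  · simp [hide]

/-! ### Rooted branching bisimilarity as a coinductive congruence -/

/-- The transitions of `s` are matched by `t`: action steps up to branching bisimilarity, and idling
up to `Q`. -/
structure RootMatch (γ : Acttd A → Acttd A → Acttd A) (Q : Term A → Term A → Prop)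
    (s t : Term A) : Prop where
  idle : IdleVal s false → IdleVal t false
  act : ∀ a s', Tr γ s (.act a) s' → ∃ t', Tr γ t (.act a) t' ∧ BB γ s' t'
  sigma : ∀ s', Tr γ s .sigma (some s') → ∃ t', Tr γ t .sigma (some t') ∧ Q s' t'

theorem RootMatch.mono {Q Q' : Term A → Term A → Prop} {s t} (h : RootMatch γ Q s t)
    (hQ : ∀ s t, Q s t → Q' s t) : RootMatch γ Q' s t :=
  ⟨h.idle, h.act, fun s' hs => (h.sigma s' hs).imp fun _ => And.imp_right (hQ _ _)⟩

/-- The largest symmetric relation all of whose pairs match each other's transitions at the root. -/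
def RB (γ : Acttd A → Acttd A → Acttd A) (s t : Term A) : Prop :=
  ∃ Q, (∀ s t, Q s t → Q t s) ∧ (∀ s t, Q s t → RootMatch γ Q s t) ∧ Q s t

theorem RB.symm {s t : Term A} : RB γ s t → RB γ t s :=
  fun ⟨Q, hs, hm, h⟩ => ⟨Q, hs, hm, hs _ _ h⟩

theorem RB.rootMatch {s t : Term A} : RB γ s t → RootMatch γ (RB γ) s t :=
  fun ⟨Q, hs, hm, h⟩ => (hm s t h).mono fun _ _ h' => ⟨Q, hs, hm, h'⟩

/-- Coinduction for symmetric relations. -/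
theorem RB.coind {Q : Term A → Term A → Prop} (hs : ∀ s t, Q s t → Q t s)
    (hm : ∀ s t, Q s t → RootMatch γ (fun s t => RB γ s t ∨ Q s t) s t) {s t} (h : Q s t) :
    RB γ s t := by
  refine ⟨fun s t => RB γ s t ∨ Q s t, ?_, ?_, .inr h⟩
  · exact fun s t h => h.imp RB.symm (hs s t)
  · rintro s t (h | h)
    · exact h.rootMatch.mono fun _ _ => .inl
    · exact hm s t h

/-- Coinduction for arbitrary relations. -/
theorem RB.coind' {Q : Term A → Term A → Prop}
    (hm : ∀ s t, Q s t → RootMatch γ (fun s t => RB γ s t ∨ Q s t) s t)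
    (hm' : ∀ s t, Q s t → RootMatch γ (fun t s => RB γ t s ∨ Q s t) t s) {s t} (h : Q s t) :
    RB γ s t := by
  refine RB.coind (Q := fun s t => Q s t ∨ Q t s) (fun _ _ => Or.symm) ?_ (.inl h)
  rintro s t (h | h)
  · exact (hm s t h).mono fun _ _ => Or.imp_right .inl
  · exact (hm' t s h).mono fun _ _ => Or.imp_right .inr

theorem RB.refl (t : Term A) : RB γ t t := by
  refine ⟨Eq, fun _ _ => Eq.symm, ?_, rfl⟩
  rintro s _ rfl
  exact ⟨id, fun a s' h => ⟨s', h, BB.refl _⟩, fun s' h => ⟨s', h, rfl⟩⟩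

theorem RB.trans {s t r : Term A} (h₁ : RB γ s t) (h₂ : RB γ t r) : RB γ s r := by
  refine RB.coind (Q := fun s r => ∃ t, RB γ s t ∧ RB γ t r) ?_ ?_ ⟨t, h₁, h₂⟩
  · rintro s r ⟨t, h, h'⟩
    exact ⟨t, h'.symm, h.symm⟩
  · rintro s r ⟨t, h, h'⟩
    refine ⟨fun k => h'.rootMatch.idle (h.rootMatch.idle k), fun a s' k => ?_, fun s' k => ?_⟩
    · obtain ⟨t', ht, hb⟩ := h.rootMatch.act _ _ k
      obtain ⟨r', hr, hb'⟩ := h'.rootMatch.act _ _ ht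
      exact ⟨r', hr, hb.trans hb'⟩
    · obtain ⟨t', ht, hb⟩ := h.rootMatch.sigma _ k
      obtain ⟨r', hr, hb'⟩ := h'.rootMatch.sigma _ ht
      exact ⟨r', hr, .inr ⟨t', hb, hb'⟩⟩

theorem RB.bb {s t : Term A} (h : RB γ s t) : BB γ (some s) (some t) := by
  refine ⟨fun p q => BB γ p q ∨ ∃ s t, RB γ s t ∧ p = some s ∧ q = some t, ?_, ?_,
    .inr ⟨s, t, h, rfl, rfl⟩⟩
  · rintro p q (h | ⟨s, t, h, rfl, rfl⟩)
    · exact .inl h.symm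
    · exact .inr ⟨_, _, h.symm, rfl, rfl⟩
  · rintro p q (h | ⟨s, t, h, rfl, rfl⟩)
    · refine ⟨fun α p' hp => ?_, fun hp => ((BB.transfer p q h).2 hp).mono fun v hv => .inl hv⟩
      refine ((BB.transfer p q h).1 _ _ hp).imp (And.imp_right .inl) ?_
      rintro ⟨r, q', hr, hq, h'⟩
      exact ⟨r, q', hr.mono fun v hv => .inl hv, hq, .inl h'⟩
    · refine ⟨fun α p' hp => .inr ?_, nofun⟩
      cases α with
      | act a =>
        obtain ⟨t', ht, hb⟩ := h.rootMatch.act _ _ hp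
        exact ⟨_, _, .refl, ht, .inl hb⟩
      | sigma =>
        obtain ⟨p', rfl⟩ := Step.sigma_isSome hp rfl
        obtain ⟨t', ht, hb⟩ := h.rootMatch.sigma _ hp
        exact ⟨_, _, .refl, ht, .inr ⟨_, _, hb, rfl, rfl⟩⟩

/-- `RootMatch` carries only the value `false`; the value `true` follows because it amounts to
having a σ-transition, and those are matched. -/
theorem RB.idleVal_iff {s t : Term A} (h : RB γ s t) (b : Bool) : IdleVal s b ↔ IdleVal t b := by
  have key : ∀ {s t : Term A}, RB γ s t → IdleVal s b → IdleVal t b := by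
    intro s t h hs
    cases b with
    | false => exact h.rootMatch.idle hs
    | true =>
      obtain ⟨s', hs⟩ := hs.exists_tr (γ := γ) rfl
      obtain ⟨t', ht, -⟩ := h.rootMatch.sigma _ hs
      exact ht.idleVal rfl
  exact ⟨key h, key h.symm⟩

theorem RB.delay {x u : Term A} (h : RB γ x u) : RB γ (.delay x) (.delay u) := by
  refine RB.coind (Q := fun s t => ∃ x u, RB γ x u ∧ s = .delay x ∧ t = .delay u) ?_ ?_
    ⟨_, _, h, rfl, rfl⟩
  · rintro s t ⟨x, u, h, rfl, rfl⟩
    exact ⟨_, _, h.symm, rfl, rfl⟩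
  · rintro s t ⟨x, u, h, rfl, rfl⟩
    refine ⟨by simp, by simp, fun s' w => ?_⟩
    obtain ⟨-, ⟨⟩⟩ := (tr_delay ..).1 w
    exact ⟨u, by simp, .inl h⟩

theorem RB.timeout {x u : Term A} (h : RB γ x u) : RB γ (.timeout x) (.timeout u) := by
  refine RB.coind (Q := fun s t => ∃ x u, RB γ x u ∧ s = .timeout x ∧ t = .timeout u) ?_ ?_
    ⟨_, _, h, rfl, rfl⟩
  · rintro s t ⟨x, u, h, rfl, rfl⟩
    exact ⟨_, _, h.symm, rfl, rfl⟩
  · rintro s t ⟨x, u, h, rfl, rfl⟩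
    exact ⟨by simp, by simpa using h.rootMatch.act, by simp⟩

theorem RB.encap (H : Set A) {x u : Term A} (h : RB γ x u) :
    RB γ (.encap H x) (.encap H u) := by
  refine RB.coind (Q := fun s t => ∃ x u, RB γ x u ∧ s = .encap H x ∧ t = .encap H u) ?_ ?_
    ⟨_, _, h, rfl, rfl⟩
  · rintro s t ⟨x, u, h, rfl, rfl⟩
    exact ⟨_, _, h.symm, rfl, rfl⟩
  · rintro s t ⟨x, u, h, rfl, rfl⟩
    refine ⟨by simpa using h.rootMatch.idle, fun a s' w => ?_, fun s' w => ?_⟩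
    · obtain ⟨x', hx, ha, rfl⟩ := (tr_encap_act ..).1 w
      obtain ⟨u', hu, hb⟩ := h.rootMatch.act _ _ hx
      exact ⟨_, (tr_encap_act ..).2 ⟨u', hu, ha, rfl⟩, hb.encap H⟩
    · obtain ⟨x', hx, ⟨⟩⟩ := (tr_encap_sigma ..).1 w
      obtain ⟨u', hu, hb⟩ := h.rootMatch.sigma _ hx
      exact ⟨_, (tr_encap_sigma ..).2 ⟨u', hu, rfl⟩, .inr ⟨_, _, hb, rfl, rfl⟩⟩

theorem RB.abstr (I : Set A) {x u : Term A} (h : RB γ x u) :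
    RB γ (.abstr I x) (.abstr I u) := by
  refine RB.coind (Q := fun s t => ∃ x u, RB γ x u ∧ s = .abstr I x ∧ t = .abstr I u) ?_ ?_
    ⟨_, _, h, rfl, rfl⟩
  · rintro s t ⟨x, u, h, rfl, rfl⟩
    exact ⟨_, _, h.symm, rfl, rfl⟩
  · rintro s t ⟨x, u, h, rfl, rfl⟩
    refine ⟨by simpa using h.rootMatch.idle, fun a s' w => ?_, fun s' w => ?_⟩
    · obtain ⟨b, x', hx, ha, rfl⟩ := (tr_abstr_act ..).1 w
      obtain ⟨u', hu, hb⟩ := h.rootMatch.act _ _ hx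
      exact ⟨_, (tr_abstr_act ..).2 ⟨b, u', hu, ha, rfl⟩, hb.abstr I⟩
    · obtain ⟨x', hx, ⟨⟩⟩ := (tr_abstr_sigma ..).1 w
      obtain ⟨u', hu, hb⟩ := h.rootMatch.sigma _ hx
      exact ⟨_, (tr_abstr_sigma ..).2 ⟨u', hu, rfl⟩, .inr ⟨_, _, hb, rfl, rfl⟩⟩

/-- This is where `RootMatch.idle` is needed: the negative premise for choice is the value `false`,
which for undecided terms is stronger than having no σ-transition. Choice is also where the root
condition matters, since an initial silent step discards the other summand. -/
theorem RB.alt {x y u v : Term A} (h : RB γ x u) (h' : RB γ y v) : RB γ (x ⊹ y) (u ⊹ v) := by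
  refine RB.coind (Q := fun s t => ∃ x y u v, RB γ x u ∧ RB γ y v ∧ s = x ⊹ y ∧ t = u ⊹ v) ?_ ?_
    ⟨_, _, _, _, h, h', rfl, rfl⟩
  · rintro s t ⟨x, y, u, v, h, h', rfl, rfl⟩
    exact ⟨_, _, _, _, h.symm, h'.symm, rfl, rfl⟩
  · rintro s t ⟨x, y, u, v, h, h', rfl, rfl⟩
    refine ⟨?_, fun a s' w => ?_, fun s' w => ?_⟩
    · rw [idleVal_alt_false, idleVal_alt_false]
      exact And.imp h.rootMatch.idle h'.rootMatch.idle
    · rcases (tr_alt_act ..).1 w with k | k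
      · obtain ⟨t', ht, hb⟩ := h.rootMatch.act _ _ k
        exact ⟨t', (tr_alt_act ..).2 (.inl ht), hb⟩
      · obtain ⟨t', ht, hb⟩ := h'.rootMatch.act _ _ k
        exact ⟨t', (tr_alt_act ..).2 (.inr ht), hb⟩
    · rcases (tr_alt_sigma ..).1 w with ⟨k, n⟩ | ⟨n, k⟩ | ⟨x', y', k, k', ⟨⟩⟩
      · obtain ⟨t', ht, hb⟩ := h.rootMatch.sigma _ k
        exact ⟨t', (tr_alt_sigma ..).2 (.inl ⟨ht, h'.rootMatch.idle n⟩), .inl hb⟩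
      · obtain ⟨t', ht, hb⟩ := h'.rootMatch.sigma _ k
        exact ⟨t', (tr_alt_sigma ..).2 (.inr (.inl ⟨h.rootMatch.idle n, ht⟩)), .inl hb⟩
      · obtain ⟨t, ht, hb⟩ := h.rootMatch.sigma _ k
        obtain ⟨t', ht', hb'⟩ := h'.rootMatch.sigma _ k'
        exact ⟨_, (tr_alt_sigma ..).2 (.inr (.inr ⟨_, _, ht, ht', rfl⟩)),
          .inr ⟨_, _, _, _, hb, hb', rfl, rfl⟩⟩

/-- Branching bisimilarity suffices for the second operand: it starts only after an action of the
first, and from then on only `BB` is required. -/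
theorem RB.seq {x y u v : Term A} (h : RB γ x u) (h' : BB γ (some y) (some v)) :
    RB γ (x ⊙ y) (u ⊙ v) := by
  refine RB.coind (Q := fun s t => ∃ x y u v, RB γ x u ∧ BB γ (some y) (some v) ∧
    s = x ⊙ y ∧ t = u ⊙ v) ?_ ?_ ⟨_, _, _, _, h, h', rfl, rfl⟩
  · rintro s t ⟨x, y, u, v, h, h', rfl, rfl⟩
    exact ⟨_, _, _, _, h.symm, h'.symm, rfl, rfl⟩
  · rintro s t ⟨x, y, u, v, h, h', rfl, rfl⟩
    refine ⟨by simpa using h.rootMatch.idle, fun a s' w => ?_, fun s' w => ?_⟩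
    · obtain ⟨x', hx, rfl⟩ := (tr_seq ..).1 w
      obtain ⟨u', hu, hb⟩ := h.rootMatch.act _ _ hx
      exact ⟨_, (tr_seq ..).2 ⟨u', hu, rfl⟩, hb.seqO h'⟩
    · obtain ⟨x', hx, ⟨⟩⟩ := (tr_seq ..).1 w
      obtain ⟨x', rfl⟩ := Step.sigma_isSome hx rfl
      obtain ⟨u', hu, hb⟩ := h.rootMatch.sigma _ hx
      exact ⟨_, (tr_seq ..).2 ⟨u', hu, rfl⟩, .inr ⟨_, _, _, _, hb, h', rfl, rfl⟩⟩

theorem RB.par (hγ : CommTau γ) {x y u v : Term A} (h : RB γ x u) (h' : RB γ y v) :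
    RB γ (x ∥ y) (u ∥ v) := by
  refine RB.coind (Q := fun s t => ∃ x y u v, RB γ x u ∧ RB γ y v ∧ s = x ∥ y ∧ t = u ∥ v) ?_ ?_
    ⟨_, _, _, _, h, h', rfl, rfl⟩
  · rintro s t ⟨x, y, u, v, h, h', rfl, rfl⟩
    exact ⟨_, _, _, _, h.symm, h'.symm, rfl, rfl⟩
  · rintro s t ⟨x, y, u, v, h, h', rfl, rfl⟩
    refine ⟨?_, fun a s' w => ?_, fun s' w => ?_⟩
    · rw [idleVal_par_false, idleVal_par_false]
      exact Or.imp h.rootMatch.idle h'.rootMatch.idle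
    · rcases (tr_par_act ..).1 w with ⟨x', k, rfl⟩ | ⟨y', k, rfl⟩ | ⟨a, b, x', y', k, k', e, rfl⟩
      · obtain ⟨t', ht, hb⟩ := h.rootMatch.act _ _ k
        exact ⟨_, (tr_par_act ..).2 (.inl ⟨_, ht, rfl⟩), hb.parO hγ h'.bb⟩
      · obtain ⟨t', ht, hb⟩ := h'.rootMatch.act _ _ k
        exact ⟨_, (tr_par_act ..).2 (.inr (.inl ⟨_, ht, rfl⟩)), h.bb.parO hγ hb⟩
      · obtain ⟨t, ht, hb⟩ := h.rootMatch.act _ _ k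
        obtain ⟨t', ht', hb'⟩ := h'.rootMatch.act _ _ k'
        exact ⟨_, (tr_par_act ..).2 (.inr (.inr ⟨_, _, _, _, ht, ht', e, rfl⟩)), hb.parO hγ hb'⟩
    · obtain ⟨x', y', k, k', ⟨⟩⟩ := (tr_par_sigma ..).1 w
      obtain ⟨t, ht, hb⟩ := h.rootMatch.sigma _ k
      obtain ⟨t', ht', hb'⟩ := h'.rootMatch.sigma _ k'
      exact ⟨_, (tr_par_sigma ..).2 ⟨_, _, ht, ht', rfl⟩, .inr ⟨_, _, _, _, hb, hb', rfl, rfl⟩⟩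

theorem RB.lmerge (hγ : CommTau γ) {x y u v : Term A} (h : RB γ x u) (h' : RB γ y v) :
    RB γ (x ⫦ y) (u ⫦ v) := by
  refine RB.coind (Q := fun s t => ∃ x y u v, RB γ x u ∧ RB γ y v ∧ s = x ⫦ y ∧ t = u ⫦ v) ?_ ?_
    ⟨_, _, _, _, h, h', rfl, rfl⟩
  · rintro s t ⟨x, y, u, v, h, h', rfl, rfl⟩
    exact ⟨_, _, _, _, h.symm, h'.symm, rfl, rfl⟩
  · rintro s t ⟨x, y, u, v, h, h', rfl, rfl⟩
    refine ⟨?_, fun a s' w => ?_, fun s' w => ?_⟩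
    · rw [idleVal_lmerge_false, idleVal_lmerge_false]
      exact Or.imp h.rootMatch.idle h'.rootMatch.idle
    · obtain ⟨x', k, rfl⟩ := (tr_lmerge_act ..).1 w
      obtain ⟨t', ht, hb⟩ := h.rootMatch.act _ _ k
      exact ⟨_, (tr_lmerge_act ..).2 ⟨_, ht, rfl⟩, hb.parO hγ h'.bb⟩
    · obtain ⟨x', y', k, k', ⟨⟩⟩ := (tr_lmerge_sigma ..).1 w
      obtain ⟨t, ht, hb⟩ := h.rootMatch.sigma _ k
      obtain ⟨t', ht', hb'⟩ := h'.rootMatch.sigma _ k'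
      exact ⟨_, (tr_lmerge_sigma ..).2 ⟨_, _, ht, ht', rfl⟩,
        .inr ⟨_, _, _, _, hb, hb', rfl, rfl⟩⟩

theorem RB.cmerge (hγ : CommTau γ) {x y u v : Term A} (h : RB γ x u) (h' : RB γ y v) :
    RB γ (x ⦀ y) (u ⦀ v) := by
  refine RB.coind (Q := fun s t => ∃ x y u v, RB γ x u ∧ RB γ y v ∧ s = x ⦀ y ∧ t = u ⦀ v) ?_ ?_
    ⟨_, _, _, _, h, h', rfl, rfl⟩
  · rintro s t ⟨x, y, u, v, h, h', rfl, rfl⟩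
    exact ⟨_, _, _, _, h.symm, h'.symm, rfl, rfl⟩
  · rintro s t ⟨x, y, u, v, h, h', rfl, rfl⟩
    refine ⟨?_, fun a s' w => ?_, fun s' w => ?_⟩
    · rw [idleVal_cmerge_false, idleVal_cmerge_false]
      exact Or.imp h.rootMatch.idle h'.rootMatch.idle
    · obtain ⟨a, b, x', y', k, k', e, rfl⟩ := (tr_cmerge_act ..).1 w
      obtain ⟨t, ht, hb⟩ := h.rootMatch.act _ _ k
      obtain ⟨t', ht', hb'⟩ := h'.rootMatch.act _ _ k'
      exact ⟨_, (tr_cmerge_act ..).2 ⟨_, _, _, _, ht, ht', e, rfl⟩, hb.parO hγ hb'⟩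
    · obtain ⟨x', y', k, k', ⟨⟩⟩ := (tr_cmerge_sigma ..).1 w
      obtain ⟨t, ht, hb⟩ := h.rootMatch.sigma _ k
      obtain ⟨t', ht', hb'⟩ := h'.rootMatch.sigma _ k'
      exact ⟨_, (tr_cmerge_sigma ..).2 ⟨_, _, ht, ht', rfl⟩,
        .inr ⟨_, _, _, _, hb, hb', rfl, rfl⟩⟩

theorem RB.fix (V : Set ℕ) (E : V → Term A) (X : V) :
    RB γ (.fix V E X) (Term.close V E (E X)) := by
  refine RB.coind' (Q := fun s t => ∃ X, s = .fix V E X ∧ t = Term.close V E (E X)) ?_ ?_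
    ⟨X, rfl, rfl⟩
  · rintro s t ⟨X, rfl, rfl⟩
    exact ⟨by simp, fun a s' h => ⟨s', (tr_fix ..).1 h, BB.refl _⟩,
      fun s' h => ⟨s', (tr_fix ..).1 h, .inl (RB.refl _)⟩⟩
  · rintro s t ⟨X, rfl, rfl⟩
    exact ⟨by simp, fun a s' h => ⟨s', (tr_fix ..).2 h, BB.refl _⟩,
      fun s' h => ⟨s', (tr_fix ..).2 h, .inl (RB.refl _)⟩⟩

/-! ### Soundness of the axioms for the operators -/

/-- A relation between terms that is a strong bisimulation up to equality. -/
theorem BB.of_pairs {P : Term A → Term A → Prop}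
    (h : ∀ s t, P s t → ∀ α s', Tr γ s α s' → ∃ t', Tr γ t α t' ∧
      (s' = t' ∨ ∃ x y, s' = some x ∧ t' = some y ∧ P x y))
    (h' : ∀ s t, P s t → ∀ α t', Tr γ t α t' → ∃ s', Tr γ s α s' ∧
      (s' = t' ∨ ∃ x y, s' = some x ∧ t' = some y ∧ P x y))
    {s t} (hst : P s t) : BB γ (some s) (some t) := by
  refine BB.of_strong (R := fun p q => p = q ∨ ∃ x y, (P x y ∨ P y x) ∧ p = some x ∧ q = some y)
    ?_ ?_ ?_ (.inr ⟨s, t, .inl hst, rfl, rfl⟩)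
  · rintro p q (rfl | ⟨x, y, h, rfl, rfl⟩)
    exacts [.inl rfl, .inr ⟨_, _, h.symm, rfl, rfl⟩]
  · rintro q (rfl | ⟨x, y, -, ⟨⟩, -⟩)
    rfl
  · rintro s t (⟨⟨⟩⟩ | ⟨x, y, hP | hP, ⟨⟩, ⟨⟩⟩) α s' hs
    · exact ⟨s', hs, .inl rfl⟩
    · obtain ⟨t', ht, rfl | ⟨x, y, rfl, rfl, hxy⟩⟩ := h _ _ hP _ _ hs
      exacts [⟨_, ht, .inl rfl⟩, ⟨_, ht, .inr ⟨_, _, .inl hxy, rfl, rfl⟩⟩]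
    · obtain ⟨t', ht, rfl | ⟨x, y, rfl, rfl, hxy⟩⟩ := h' _ _ hP _ _ hs
      exacts [⟨_, ht, .inl rfl⟩, ⟨_, ht, .inr ⟨_, _, .inr hxy, rfl, rfl⟩⟩]

/-- With `BB.encap_seq`, `BB.abstr_seq` and `BB.par_comm` it relates the residuals of the sequencing
and merge axioms after an action. Only the first operand evolves until it terminates, at which point
both sides coincide. -/
theorem BB.seq_assoc (x y z : Term A) : BB γ (some ((x ⊙ y) ⊙ z)) (some (x ⊙ (y ⊙ z))) := by
  refine BB.of_pairs (P := fun s t => ∃ x, s = (x ⊙ y) ⊙ z ∧ t = x ⊙ (y ⊙ z)) ?_ ?_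
    ⟨x, rfl, rfl⟩
  · rintro s t ⟨x, rfl, rfl⟩ α s' h
    simp only [tr_seq] at h ⊢
    obtain ⟨_, ⟨x', h, rfl⟩, rfl⟩ := h
    refine ⟨_, ⟨x', h, rfl⟩, ?_⟩
    cases x' <;> simp
  · rintro s t ⟨x, rfl, rfl⟩ α s' h
    simp only [tr_seq] at h ⊢
    obtain ⟨x', h, rfl⟩ := h
    refine ⟨_, ⟨_, ⟨x', h, rfl⟩, rfl⟩, ?_⟩
    cases x' <;> simp

theorem BB.encap_seq (H) (x y : Term A) :
    BB γ (some (.encap H (x ⊙ y))) (some (.encap H x ⊙ .encap H y)) := by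
  refine BB.of_pairs (P := fun s t => ∃ x, s = .encap H (x ⊙ y) ∧ t = .encap H x ⊙ .encap H y)
    ?_ ?_ ⟨x, rfl, rfl⟩
  · rintro s t ⟨x, rfl, rfl⟩ (a | _) s' h
    · simp only [tr_seq, tr_encap_act] at h ⊢
      obtain ⟨_, ⟨x', h, rfl⟩, ha, rfl⟩ := h
      refine ⟨_, ⟨_, ⟨x', h, ha, rfl⟩, rfl⟩, ?_⟩
      cases x' <;> simp
    · simp only [tr_seq, tr_encap_sigma] at h ⊢
      obtain ⟨_, ⟨x', h, ⟨⟩⟩, rfl⟩ := h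
      obtain ⟨x', rfl⟩ := Step.sigma_isSome h rfl
      exact ⟨_, ⟨_, ⟨x', h, rfl⟩, rfl⟩, by simp⟩
  · rintro s t ⟨x, rfl, rfl⟩ (a | _) s' h
    · simp only [tr_seq, tr_encap_act] at h ⊢
      obtain ⟨_, ⟨x', h, ha, rfl⟩, rfl⟩ := h
      refine ⟨_, ⟨_, ⟨x', h, rfl⟩, ha, rfl⟩, ?_⟩
      cases x' <;> simp
    · simp only [tr_seq, tr_encap_sigma] at h ⊢
      obtain ⟨_, ⟨x', h, rfl⟩, rfl⟩ := h
      exact ⟨_, ⟨_, ⟨_, h, rfl⟩, rfl⟩, by simp⟩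

theorem BB.abstr_seq (I) (x y : Term A) :
    BB γ (some (.abstr I (x ⊙ y))) (some (.abstr I x ⊙ .abstr I y)) := by
  refine BB.of_pairs (P := fun s t => ∃ x, s = .abstr I (x ⊙ y) ∧ t = .abstr I x ⊙ .abstr I y)
    ?_ ?_ ⟨x, rfl, rfl⟩
  · rintro s t ⟨x, rfl, rfl⟩ (a | _) s' h
    · simp only [tr_seq, tr_abstr_act] at h ⊢
      obtain ⟨b, _, ⟨x', h, rfl⟩, ha, rfl⟩ := h
      refine ⟨_, ⟨_, ⟨b, x', h, ha, rfl⟩, rfl⟩, ?_⟩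
      cases x' <;> simp
    · simp only [tr_seq, tr_abstr_sigma] at h ⊢
      obtain ⟨_, ⟨x', h, ⟨⟩⟩, rfl⟩ := h
      obtain ⟨x', rfl⟩ := Step.sigma_isSome h rfl
      exact ⟨_, ⟨_, ⟨x', h, rfl⟩, rfl⟩, by simp⟩
  · rintro s t ⟨x, rfl, rfl⟩ (a | _) s' h
    · simp only [tr_seq, tr_abstr_act] at h ⊢
      obtain ⟨_, ⟨b, x', h, ha, rfl⟩, rfl⟩ := h
      refine ⟨_, ⟨b, _, ⟨x', h, rfl⟩, ha, rfl⟩, ?_⟩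
      cases x' <;> simp
    · simp only [tr_seq, tr_abstr_sigma] at h ⊢
      obtain ⟨_, ⟨x', h, rfl⟩, rfl⟩ := h
      exact ⟨_, ⟨_, ⟨_, h, rfl⟩, rfl⟩, by simp⟩

theorem BB.par_comm (hγ : CommTau γ) (x y : Term A) :
    BB γ (some (x ∥ y)) (some (y ∥ x)) := by
  have key : ∀ s t : Term A, (∃ x y, s = x ∥ y ∧ t = y ∥ x) → ∀ α s', Tr γ s α s' →
      ∃ t', Tr γ t α t' ∧ (s' = t' ∨ ∃ u v, s' = some u ∧ t' = some v ∧
        ∃ x y, u = x ∥ y ∧ v = y ∥ x) := by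
    rintro s t ⟨x, y, rfl, rfl⟩ (a | _) s' h
    · rcases (tr_par_act ..).1 h with ⟨x', k, rfl⟩ | ⟨y', k, rfl⟩ | ⟨a, b, x', y', k, k', e, rfl⟩
      · refine ⟨_, (tr_par_act ..).2 (.inr (.inl ⟨_, k, rfl⟩)), ?_⟩
        cases x' <;> simp
      · refine ⟨_, (tr_par_act ..).2 (.inl ⟨_, k, rfl⟩), ?_⟩
        cases y' <;> simp
      · refine ⟨_, (tr_par_act ..).2 (.inr (.inr ⟨_, _, _, _, k', k, hγ.comm _ _ ▸ e, rfl⟩)), ?_⟩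
        cases x' <;> cases y' <;> simp
    · obtain ⟨x', y', k, k', rfl⟩ := (tr_par_sigma ..).1 h
      exact ⟨_, (tr_par_sigma ..).2 ⟨_, _, k', k, rfl⟩, by simp⟩
  refine BB.of_pairs (P := fun s t => ∃ x y, s = x ∥ y ∧ t = y ∥ x) key ?_ ⟨x, y, rfl, rfl⟩
  rintro s t ⟨x, y, rfl, rfl⟩ α t' h
  obtain ⟨s', hs, h⟩ := key _ _ ⟨y, x, rfl, rfl⟩ α t' h
  refine ⟨s', hs, h.imp Eq.symm ?_⟩
  rintro ⟨u, v, rfl, rfl, x, y, rfl, rfl⟩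
  exact ⟨_, _, rfl, rfl, _, _, rfl, rfl⟩

theorem BB.parO_comm (hγ : CommTau γ) (p q : Option (Term A)) :
    BB γ (DRT.parO p q) (DRT.parO q p) := by
  cases p <;> cases q <;> first | exact BB.par_comm hγ _ _ | (simpa using BB.refl _)

/-- The trichotomy true, false, undecided, phrased so that the simplifier can compute the
σ-transitions of a compound term from those of its parts. The third case cannot be dropped here,
because totality of the evaluation is proved later from the soundness of the axioms. -/
theorem idle_cases (γ : Acttd A → Acttd A → Acttd A) (x : Term A) :
    (∃ x', (∀ s, Tr γ x .sigma s ↔ s = some x') ∧ ¬ IdleVal x false) ∨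
      ((∀ s, ¬ Tr γ x .sigma s) ∧ IdleVal x false) ∨
      ((∀ s, ¬ Tr γ x .sigma s) ∧ ¬ IdleVal x false) := by
  by_cases h : ∃ s, Tr γ x .sigma s
  · obtain ⟨s, h⟩ := h
    obtain ⟨x', rfl⟩ := Step.sigma_isSome h rfl
    exact .inl ⟨x', fun s => ⟨fun hs => hs.sigma_unique h rfl, fun hs => hs ▸ h⟩, h.not_idleVal⟩
  · simp only [not_exists] at h
    by_cases n : IdleVal x false
    · exact .inr (.inl ⟨h, n⟩)
    · exact .inr (.inr ⟨h, n⟩)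

theorem Ax.idleVal_false {s t : Term A} (h : Ax γ s t) :
    IdleVal s false ↔ IdleVal t false := by
  cases h <;> simp <;> tauto

/-- Idling turns an axiom instance into an axiom instance or into an identity, so that `Ax` itself
can serve as a coinduction invariant for `RB`. The axioms in which several operands idle together
are checked over all combinations of idling behaviour of these operands. -/
theorem Ax.sigma {s t s' : Term A} (h : Ax γ s t) (hs : Tr γ s .sigma (some s')) :
    ∃ t', Tr γ t .sigma (some t') ∧ (s' = t' ∨ Ax γ s' t') := by
  cases h with
  | A2 x y z | A4 x y z | CM4 x y z | CM8 x y z | CM9 x y z =>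
    rcases idle_cases γ x with ⟨x', hx, nx⟩ | ⟨hx, nx⟩ | ⟨hx, nx⟩ <;>
    rcases idle_cases γ y with ⟨y', hy, ny⟩ | ⟨hy, ny⟩ | ⟨hy, ny⟩ <;>
    rcases idle_cases γ z with ⟨z', hz, nz⟩ | ⟨hz, nz⟩ | ⟨hz, nz⟩ <;>
    simp [*] at hs ⊢ <;> subst hs <;> first | exact .inl rfl | exact .inr (by constructor)
  | A1 x y | CM1 x y | D3 _ x y | TI3 _ x y | A5 x y | D4 _ x y | TI4 _ x y =>
    rcases idle_cases γ x with ⟨x', hx, nx⟩ | ⟨hx, nx⟩ | ⟨hx, nx⟩ <;>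
    rcases idle_cases γ y with ⟨y', hy, ny⟩ | ⟨hy, ny⟩ | ⟨hy, ny⟩ <;>
    simp [*] at hs ⊢ <;> subst hs <;> first | exact .inl rfl | exact .inr (by constructor)
  | A3 | A6DR =>
    rcases idle_cases γ t with ⟨x', hx, nx⟩ | ⟨hx, nx⟩ | ⟨hx, nx⟩ <;>
    simp [*] at hs ⊢ <;> subst hs <;> first | exact .inl rfl | exact .inr (by constructor)
  | _ => simp_all

theorem Ax.sigma' {s t t' : Term A} (h : Ax γ s t) (ht : Tr γ t .sigma (some t')) :
    ∃ s', Tr γ s .sigma (some s') ∧ (s' = t' ∨ Ax γ s' t') := by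
  cases h with
  | A2 x y z | A4 x y z | CM4 x y z | CM8 x y z | CM9 x y z =>
    rcases idle_cases γ x with ⟨x', hx, nx⟩ | ⟨hx, nx⟩ | ⟨hx, nx⟩ <;>
    rcases idle_cases γ y with ⟨y', hy, ny⟩ | ⟨hy, ny⟩ | ⟨hy, ny⟩ <;>
    rcases idle_cases γ z with ⟨z', hz, nz⟩ | ⟨hz, nz⟩ | ⟨hz, nz⟩ <;>
    simp [*] at ht ⊢ <;> subst ht <;> first | exact .inl rfl | exact .inr (by constructor)
  | A1 x y | CM1 x y | D3 _ x y | TI3 _ x y | A5 x y | D4 _ x y | TI4 _ x y =>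
    rcases idle_cases γ x with ⟨x', hx, nx⟩ | ⟨hx, nx⟩ | ⟨hx, nx⟩ <;>
    rcases idle_cases γ y with ⟨y', hy, ny⟩ | ⟨hy, ny⟩ | ⟨hy, ny⟩ <;>
    simp [*] at ht ⊢ <;> subst ht <;> first | exact .inl rfl | exact .inr (by constructor)
  | A3 | A6DR =>
    rcases idle_cases γ t with ⟨x', hx, nx⟩ | ⟨hx, nx⟩ | ⟨hx, nx⟩ <;>
    simp [*] at ht ⊢ <;> subst ht <;> first | exact .inl rfl | exact .inr (by constructor)
  | _ => simp_all

@[simp] theorem acttd_ofActt_in (a : Actt A) (H : Set A) :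
    (Acttd.ofActt a).In H ↔ a.In H := by
  simp [Acttd.In, Actt.In, Acttd.basic]

@[simp] theorem not_dead_in (H : Set A) : ¬ (Acttd.dead : Acttd A).In H := by
  simp [Acttd.In, Acttd.basic]

theorem Ax.act (hγ : CommTau γ) {s t : Term A} (h : Ax γ s t) (a : Actt A) :
    (∀ s', Tr γ s (.act a) s' → ∃ t', Tr γ t (.act a) t' ∧ BB γ s' t') ∧
      ∀ t', Tr γ t (.act a) t' → ∃ s', Tr γ s (.act a) s' ∧ BB γ s' t' := by
  have of_iff : ∀ {s t : Term A}, (∀ s', Tr γ s (.act a) s' ↔ Tr γ t (.act a) s') →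
    (∀ s', Tr γ s (.act a) s' → ∃ t', Tr γ t (.act a) t' ∧ BB γ s' t') ∧
      ∀ t', Tr γ t (.act a) t' → ∃ s', Tr γ s (.act a) s' ∧ BB γ s' t' :=
    fun h => ⟨fun s' hs => ⟨s', (h s').1 hs, BB.refl _⟩,
      fun s' hs => ⟨s', (h s').2 hs, BB.refl _⟩⟩
  -- For the branching axioms both sides are prefixed by the same constant, which protects the root:
  -- what follows it need only be branching bisimilar.
  have of_prefix : ∀ {b : Acttd A} {p q : Option (Term A)} {s t : Term A},
    (∀ c s', Tr γ s (.act c) s' ↔ b = .ofActt c ∧ s' = p) →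
    (∀ c s', Tr γ t (.act c) s' ↔ b = .ofActt c ∧ s' = q) → BB γ p q →
    (∀ s', Tr γ s (.act a) s' → ∃ t', Tr γ t (.act a) t' ∧ BB γ s' t') ∧
      ∀ t', Tr γ t (.act a) t' → ∃ s', Tr γ s (.act a) s' ∧ BB γ s' t' := by
    intro b p q s t hs ht hb
    refine ⟨fun s' h => ⟨q, ?_⟩, fun s' h => ⟨p, ?_⟩⟩ <;> simp_all
  cases h with
  | A5 x y z =>
    simp only [tr_seq]
    constructor
    · rintro _ ⟨_, ⟨x', h, rfl⟩, rfl⟩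
      refine ⟨_, ⟨x', h, rfl⟩, ?_⟩
      cases x'
      exacts [BB.refl _, BB.seq_assoc _ _ _]
    · rintro _ ⟨x', h, rfl⟩
      refine ⟨_, ⟨_, ⟨x', h, rfl⟩, rfl⟩, ?_⟩
      cases x'
      exacts [BB.refl _, BB.seq_assoc _ _ _]
  | D4 H x y =>
    simp only [tr_seq, tr_encap_act]
    constructor
    · rintro _ ⟨_, ⟨x', h, rfl⟩, ha, rfl⟩
      refine ⟨_, ⟨_, ⟨x', h, ha, rfl⟩, rfl⟩, ?_⟩
      cases x'
      exacts [BB.refl _, BB.encap_seq _ _ _]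
    · rintro _ ⟨_, ⟨x', h, ha, rfl⟩, rfl⟩
      refine ⟨_, ⟨_, ⟨x', h, rfl⟩, ha, rfl⟩, ?_⟩
      cases x'
      exacts [BB.refl _, BB.encap_seq _ _ _]
  | TI4 I x y =>
    simp only [tr_seq, tr_abstr_act]
    constructor
    · rintro _ ⟨b, _, ⟨x', h, rfl⟩, ha, rfl⟩
      refine ⟨_, ⟨_, ⟨b, x', h, ha, rfl⟩, rfl⟩, ?_⟩
      cases x'
      exacts [BB.refl _, BB.abstr_seq _ _ _]
    · rintro _ ⟨_, ⟨b, x', h, ha, rfl⟩, rfl⟩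
      refine ⟨_, ⟨b, _, ⟨x', h, rfl⟩, ha, rfl⟩, ?_⟩
      cases x'
      exacts [BB.refl _, BB.abstr_seq _ _ _]
  | CM1 x y =>
    simp only [tr_par_act, tr_alt_act, tr_lmerge_act, tr_cmerge_act]
    constructor
    · rintro _ (h | ⟨y', h, rfl⟩ | h)
      · exact ⟨_, .inl (.inl h), BB.refl _⟩
      · exact ⟨_, .inl (.inr ⟨y', h, rfl⟩), BB.parO_comm hγ _ _⟩
      · exact ⟨_, .inr h, BB.refl _⟩
    · rintro _ ((h | ⟨y', h, rfl⟩) | h)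
      · exact ⟨_, .inl h, BB.refl _⟩
      · exact ⟨_, .inr (.inl ⟨y', h, rfl⟩), BB.parO_comm hγ _ _⟩
      · exact ⟨_, .inr (.inr h), BB.refl _⟩
  | DRB1 b =>
    refine of_prefix (b := b) (p := some (.cts .tau)) (q := none) ?_ ?_ ?_
    · intro c s'
      simp
    · simp
    · exact BB.of_silent (by simp [Acttd.tau]) (by simp [Acttd.tau])
  | DRB2 b x y =>
    refine of_prefix (b := b) (p := some (.cts .tau ⊙ (.timeout x ⊹ y) ⊹ .timeout x))
      (q := some (.timeout x ⊹ y)) (by simp) (by simp) (BB.of_silent ?_ ?_)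
    · simp [Acttd.tau]
    · rintro (a | _) s' <;> simp [Acttd.tau] <;> grind
  -- The summand `y` may idle. The term reached by the silent step then idles to the same state,
  -- because its other summand, being a time-out, has the value `false`.
  | DRB3 b x y =>
    refine of_prefix (b := b) (p := some (.cts .tau ⊙ (.timeout x ⊹ y) ⊹ y))
      (q := some (.timeout x ⊹ y)) (by simp) (by simp) (BB.of_silent ?_ ?_)
    · simp [Acttd.tau]
    · rintro (a | _) s' <;> simp [Acttd.tau] <;> grind
  | DRB4 b x y =>
    -- The silent step of this axiom appears only after the delay, so `BB.of_silent` applies to the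
    -- states after idling, and `BB.of_match` lifts the result to the states before.
    have hx : BB γ (some (.cts .tau ⊙ x)) (some x) :=
      BB.of_silent (by simp [Acttd.tau]) fun α s' h => by
        obtain ⟨_, ⟨c, ⟨⟩, rfl, rfl⟩, rfl⟩ := by simpa only [tr_seq, tr_cts] using h
        exact .inl ⟨rfl, rfl⟩
    refine of_prefix (b := b) (p := some (.delay (.cts .tau ⊙ x) ⊹ .timeout y))
      (q := some (.delay x ⊹ .timeout y)) (by simp) (by simp) (BB.of_match ?_ ?_)
    · rintro (a | _) s' h
      · exact ⟨s', by simpa using h, BB.refl _⟩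
      · exact ⟨some x, by simp, by simp_all⟩
    · rintro (a | _) s' h
      · exact ⟨s', by simpa using h, BB.refl _⟩
      · exact ⟨some (.cts .tau ⊙ x), by simp, by simp_all⟩
  | D1DR H b hb =>
    refine of_iff fun s' => ?_
    simp
    rintro rfl -
    simpa using hb
  | D2DR H b hb =>
    refine of_iff fun s' => ?_
    simp
    rintro rfl h
    simp [h] at hb
  | TI1DR I b hb =>
    refine of_iff fun s' => ?_
    rcases b with b | _
    · have hb' : ¬ b.In I := by simpa using hb
      simp [hide, hb', eq_comm]
    · simp
  | TI2DR I b hb =>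
    refine of_iff fun s' => ?_
    rcases b with b | _
    · have hb' : b.In I := by simpa using hb
      simp [hide, hb', eq_comm, Acttd.tau]
    · simp at hb
  | CFDR b c d e =>
    refine of_iff fun s' => ?_
    subst e
    rcases b with b | _ <;> rcases c with c | _ <;> simp [hγ.dead, hγ.comm _ .dead]
  | CM9 x y z =>
    refine of_iff fun s' => ?_
    simp only [tr_cmerge_act, tr_alt_act]
    constructor
    · rintro ⟨a, b, x', y', h, h' | h', e⟩
      exacts [.inl ⟨a, b, x', y', h, h', e⟩, .inr ⟨a, b, x', y', h, h', e⟩]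
    · rintro (⟨a, b, x', y', h, h', e⟩ | ⟨a, b, x', y', h, h', e⟩)
      exacts [⟨a, b, x', y', h, .inl h', e⟩, ⟨a, b, x', y', h, .inr h', e⟩]
  | _ =>
    refine of_iff fun s' => ?_
    simp
    try grind

theorem Ax.rb (hγ : CommTau γ) {s t : Term A} (h : Ax γ s t) : RB γ s t := by
  have aux : ∀ {s t : Term A}, s = t ∨ Ax γ s t → RB γ s t ∨ Ax γ s t :=
    by
    rintro s t (rfl | h)
    exacts [.inl (RB.refl _), .inr h]
  refine RB.coind' (fun s t h => ?_) (fun s t h => ?_) h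
  · exact ⟨h.idleVal_false.1, (h.act hγ · |>.1),
      fun s' hs => (h.sigma hs).imp fun _ => And.imp_right aux⟩
  · refine ⟨h.idleVal_false.2, fun a s' hs => ?_, fun s' hs => ?_⟩
    · exact ((h.act hγ a).2 s' hs).imp fun _ => And.imp_right BB.symm
    · exact (h.sigma' hs).imp fun _ => And.imp_right fun h => (aux h).imp_left RB.symm

/-! ### Bisimulation up to guarded contexts -/

/-- Closure of a relation under contexts without abstraction. -/
inductive Ctx (P : Term A → Term A → Prop) : Term A → Term A → Prop
  | refl (t) : Ctx P t t
  | base {s t} : P s t → Ctx P s t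
  | alt {x y u v} : Ctx P x u → Ctx P y v → Ctx P (x ⊹ y) (u ⊹ v)
  | seq {x y u v} : Ctx P x u → Ctx P y v → Ctx P (x ⊙ y) (u ⊙ v)
  | delay {x u} : Ctx P x u → Ctx P (.delay x) (.delay u)
  | par {x y u v} : Ctx P x u → Ctx P y v → Ctx P (x ∥ y) (u ∥ v)
  | lmerge {x y u v} : Ctx P x u → Ctx P y v → Ctx P (x ⫦ y) (u ⫦ v)
  | cmerge {x y u v} : Ctx P x u → Ctx P y v → Ctx P (x ⦀ y) (u ⦀ v)
  | encap {H x u} : Ctx P x u → Ctx P (.encap H x) (.encap H u)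
  | timeout {x u} : Ctx P x u → Ctx P (.timeout x) (.timeout u)

/-- Closure of a relation under guarded contexts without abstraction. -/
inductive GCtx (P : Term A → Term A → Prop) : Term A → Term A → Prop
  | refl (t) : GCtx P t t
  | alt {x y u v} : GCtx P x u → GCtx P y v → GCtx P (x ⊹ y) (u ⊹ v)
  | seq {x y u v} : GCtx P x u → GCtx P y v → GCtx P (x ⊙ y) (u ⊙ v)
  | pre (a : A) {x u} : Ctx P x u → GCtx P (.cts (.basic a) ⊙ x) (.cts (.basic a) ⊙ u)
  | delay {x u} : Ctx P x u → GCtx P (.delay x) (.delay u)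
  | par {x y u v} : GCtx P x u → GCtx P y v → GCtx P (x ∥ y) (u ∥ v)
  | lmerge {x y u v} : GCtx P x u → GCtx P y v → GCtx P (x ⫦ y) (u ⫦ v)
  | cmerge {x y u v} : GCtx P x u → GCtx P y v → GCtx P (x ⦀ y) (u ⦀ v)
  | encap {H x u} : GCtx P x u → GCtx P (.encap H x) (.encap H u)
  | timeout {x u} : GCtx P x u → GCtx P (.timeout x) (.timeout u)

variable {P : Term A → Term A → Prop}

theorem GCtx.ctx {s t : Term A} (h : GCtx P s t) : Ctx P s t := by
  induction h with
  | refl t => exact .refl t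
  | alt _ _ h h' => exact .alt h h'
  | seq _ _ h h' => exact .seq h h'
  | pre a h => exact .seq (.refl _) h
  | delay h => exact .delay h
  | par _ _ h h' => exact .par h h'
  | lmerge _ _ h h' => exact .lmerge h h'
  | cmerge _ _ h h' => exact .cmerge h h'
  | encap _ h => exact .encap h
  | timeout _ h => exact .timeout h

theorem Ctx.symm (hP : ∀ s t, P s t → P t s) {s t : Term A} (h : Ctx P s t) : Ctx P t s := by
  induction h with
  | refl t => exact .refl t
  | base h => exact .base (hP _ _ h)
  | alt _ _ h h' => exact .alt h h'
  | seq _ _ h h' => exact .seq h h'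
  | delay _ h => exact .delay h
  | par _ _ h h' => exact .par h h'
  | lmerge _ _ h h' => exact .lmerge h h'
  | cmerge _ _ h h' => exact .cmerge h h'
  | encap _ h => exact .encap h
  | timeout _ h => exact .timeout h

theorem GCtx.idle {s t : Term A} (h : GCtx P s t) (hs : IdleVal s false) : IdleVal t false := by
  induction h <;> simp_all <;> tauto

theorem Ctx.seqO {p q : Option (Term A)} (h : Option.Rel (Ctx P) p q) {y z : Term A}
    (h' : Ctx P y z) : Option.Rel (Ctx P) (some (seqO p y)) (some (seqO q z)) := by
  cases h with
  | none => exact .some h'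
  | some h => exact .some (.seq h h')

theorem GCtx.seqO {p q : Option (Term A)} (h : Option.Rel (GCtx P) p q) {y z : Term A}
    (h' : GCtx P y z) : Option.Rel (GCtx P) (some (seqO p y)) (some (seqO q z)) := by
  cases h with
  | none => exact .some h'
  | some h => exact .some (.seq h h')

theorem Ctx.parO {p q p' q' : Option (Term A)} (h : Option.Rel (Ctx P) p q)
    (h' : Option.Rel (Ctx P) p' q') : Option.Rel (Ctx P) (parO p p') (parO q q') := by
  cases h <;> cases h' <;> first | exact .none | exact .some ‹_› | exact .some (.par ‹_› ‹_›)

theorem GCtx.parO {p q p' q' : Option (Term A)} (h : Option.Rel (GCtx P) p q)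
    (h' : Option.Rel (GCtx P) p' q') : Option.Rel (GCtx P) (parO p p') (parO q q') := by
  cases h <;> cases h' <;> first | exact .none | exact .some ‹_› | exact .some (.par ‹_› ‹_›)

theorem Ctx.mapEncap (H : Set A) {p q : Option (Term A)} (h : Option.Rel (Ctx P) p q) :
    Option.Rel (Ctx P) (p.map (.encap H)) (q.map (.encap H)) := by
  cases h with
  | none => exact .none
  | some h => exact .some (.encap h)

theorem GCtx.mapEncap (H : Set A) {p q : Option (Term A)} (h : Option.Rel (GCtx P) p q) :
    Option.Rel (GCtx P) (p.map (.encap H)) (q.map (.encap H)) := by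
  cases h with
  | none => exact .none
  | some h => exact .some (.encap h)

theorem optionRel_refl {Q : Term A → Term A → Prop} (hQ : ∀ t, Q t t)
    (p : Option (Term A)) : Option.Rel Q p p := by
  cases p with
  | none => exact .none
  | some t => exact .some (hQ t)

/-- Guarded contexts have the same transitions up to contexts, and up to guarded contexts if the
transition is silent. -/
theorem GCtx.tr (hγ : CommTau γ) {s t : Term A} (h : GCtx P s t) :
    ∀ {α s'}, Tr γ s α s' → ∃ t', Tr γ t α t' ∧ Option.Rel (Ctx P) s' t' ∧
      (α = .act .tau → Option.Rel (GCtx P) s' t') := by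
  induction h with
  | refl t =>
    intro α s' hs
    exact ⟨s', hs, optionRel_refl .refl _, fun _ => optionRel_refl .refl _⟩
  | @alt x y u v h h' ih ih' =>
    rintro (a | _) s' hs
    · rcases (tr_alt_act ..).1 hs with k | k
      · obtain ⟨t', ht, hr⟩ := ih k
        exact ⟨t', (tr_alt_act ..).2 (.inl ht), hr⟩
      · obtain ⟨t', ht, hr⟩ := ih' k
        exact ⟨t', (tr_alt_act ..).2 (.inr ht), hr⟩
    · rcases (tr_alt_sigma ..).1 hs with ⟨k, n⟩ | ⟨n, k⟩ | ⟨x', y', k, k', rfl⟩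
      · obtain ⟨t', ht, hr⟩ := ih k
        exact ⟨t', (tr_alt_sigma ..).2 (.inl ⟨ht, h'.idle n⟩), hr⟩
      · obtain ⟨t', ht, hr⟩ := ih' k
        exact ⟨t', (tr_alt_sigma ..).2 (.inr (.inl ⟨h.idle n, ht⟩)), hr⟩
      · obtain ⟨_, ht, ⟨hr⟩, -⟩ := ih k
        obtain ⟨_, ht', ⟨hr'⟩, -⟩ := ih' k'
        exact ⟨_, (tr_alt_sigma ..).2 (.inr (.inr ⟨_, _, ht, ht', rfl⟩)), .some (.alt hr hr'),
          nofun⟩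
  | @seq x y u v h h' ih ih' =>
    intro α s' hs
    obtain ⟨x', k, rfl⟩ := (tr_seq ..).1 hs
    obtain ⟨t', ht, hr, hr'⟩ := ih k
    -- If the first operand terminates silently, the second is exposed; this is why `GCtx.seq`
    -- requires both operands to be guarded.
    exact ⟨_, (tr_seq ..).2 ⟨t', ht, rfl⟩, Ctx.seqO hr h'.ctx, fun e => GCtx.seqO (hr' e) h'⟩
  | @pre a x u h =>
    intro α s' hs
    obtain ⟨x', k, rfl⟩ := (tr_seq ..).1 hs
    obtain ⟨b, ⟨⟩, rfl, rfl⟩ := (tr_cts ..).1 k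
    -- Consuming the prefix removes the guard, but the prefix is a basic action, so the step is not
    -- silent.
    exact ⟨_, (tr_seq ..).2 ⟨_, k, rfl⟩, .some h, nofun⟩
  | @delay x u h =>
    intro α s' hs
    obtain ⟨rfl, rfl⟩ := (tr_delay ..).1 hs
    exact ⟨some u, by simp, .some h, nofun⟩
  | @par x y u v h h' ih ih' =>
    rintro (c | _) s' hs
    · rcases (tr_par_act ..).1 hs with ⟨x', k, rfl⟩ | ⟨y', k, rfl⟩ | ⟨a, b, x', y', k, k', e, rfl⟩
      · obtain ⟨t', ht, hr, hr'⟩ := ih k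
        exact ⟨_, (tr_par_act ..).2 (.inl ⟨_, ht, rfl⟩), Ctx.parO hr (.some h'.ctx),
          fun e => GCtx.parO (hr' e) (.some h')⟩
      · obtain ⟨t', ht, hr, hr'⟩ := ih' k
        exact ⟨_, (tr_par_act ..).2 (.inr (.inl ⟨_, ht, rfl⟩)), Ctx.parO (.some h.ctx) hr,
          fun e => GCtx.parO (.some h) (hr' e)⟩
      · obtain ⟨t, ht, hr, -⟩ := ih k
        obtain ⟨t', ht', hr', -⟩ := ih' k'
        refine ⟨_, (tr_par_act ..).2 (.inr (.inr ⟨_, _, _, _, ht, ht', e, rfl⟩)),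
          Ctx.parO hr hr', ?_⟩
        -- A communication may consume guards on both sides, but its result is visible.
        rintro ⟨⟩
        exact (hγ.ne e rfl).elim
    · obtain ⟨x', y', k, k', rfl⟩ := (tr_par_sigma ..).1 hs
      obtain ⟨_, ht, ⟨hr⟩, -⟩ := ih k
      obtain ⟨_, ht', ⟨hr'⟩, -⟩ := ih' k'
      exact ⟨_, (tr_par_sigma ..).2 ⟨_, _, ht, ht', rfl⟩, .some (.par hr hr'), nofun⟩
  | @lmerge x y u v h h' ih ih' =>
    rintro (c | _) s' hs
    · obtain ⟨x', k, rfl⟩ := (tr_lmerge_act ..).1 hs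
      obtain ⟨t', ht, hr, hr'⟩ := ih k
      exact ⟨_, (tr_lmerge_act ..).2 ⟨_, ht, rfl⟩, Ctx.parO hr (.some h'.ctx),
        fun e => GCtx.parO (hr' e) (.some h')⟩
    · obtain ⟨x', y', k, k', rfl⟩ := (tr_lmerge_sigma ..).1 hs
      obtain ⟨_, ht, ⟨hr⟩, -⟩ := ih k
      obtain ⟨_, ht', ⟨hr'⟩, -⟩ := ih' k'
      exact ⟨_, (tr_lmerge_sigma ..).2 ⟨_, _, ht, ht', rfl⟩, .some (.lmerge hr hr'), nofun⟩
  | @cmerge x y u v h h' ih ih' =>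
    rintro (c | _) s' hs
    · obtain ⟨a, b, x', y', k, k', e, rfl⟩ := (tr_cmerge_act ..).1 hs
      obtain ⟨t, ht, hr, -⟩ := ih k
      obtain ⟨t', ht', hr', -⟩ := ih' k'
      refine ⟨_, (tr_cmerge_act ..).2 ⟨_, _, _, _, ht, ht', e, rfl⟩, Ctx.parO hr hr', ?_⟩
      rintro ⟨⟩
      exact (hγ.ne e rfl).elim
    · obtain ⟨x', y', k, k', rfl⟩ := (tr_cmerge_sigma ..).1 hs
      obtain ⟨_, ht, ⟨hr⟩, -⟩ := ih k
      obtain ⟨_, ht', ⟨hr'⟩, -⟩ := ih' k'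
      exact ⟨_, (tr_cmerge_sigma ..).2 ⟨_, _, ht, ht', rfl⟩, .some (.cmerge hr hr'), nofun⟩
  | @encap H x u h ih =>
    rintro (c | _) s' hs
    · obtain ⟨x', k, hc, rfl⟩ := (tr_encap_act ..).1 hs
      obtain ⟨t', ht, hr, hr'⟩ := ih k
      exact ⟨_, (tr_encap_act ..).2 ⟨_, ht, hc, rfl⟩, Ctx.mapEncap H hr,
        fun e => GCtx.mapEncap H (hr' e)⟩
    · obtain ⟨x', k, rfl⟩ := (tr_encap_sigma ..).1 hs
      obtain ⟨_, ht, ⟨hr⟩, -⟩ := ih k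
      exact ⟨_, (tr_encap_sigma ..).2 ⟨_, ht, rfl⟩, .some (.encap hr), nofun⟩
  | @timeout x u h ih =>
    rintro (c | _) s' hs
    · obtain ⟨t', ht, hr⟩ := ih ((tr_timeout_act ..).1 hs)
      exact ⟨t', (tr_timeout_act ..).2 ht, hr⟩
    · exact (tr_timeout_sigma _ _ hs).elim

/-- If related terms can be rewritten to guarded contexts of related terms, then so can contexts
of related terms. -/
theorem Ctx.exists_gctx (hγ : CommTau γ)
    (hP : ∀ s t, P s t → ∃ s' t', RB γ s s' ∧ RB γ t t' ∧ GCtx P s' t') {s t : Term A}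
    (h : Ctx P s t) : ∃ s' t', RB γ s s' ∧ RB γ t t' ∧ GCtx P s' t' := by
  induction h with
  | refl t => exact ⟨t, t, .refl t, .refl t, .refl t⟩
  | base h => exact hP _ _ h
  | alt _ _ h h' =>
    obtain ⟨s, t, hs, ht, hg⟩ := h
    obtain ⟨s', t', hs', ht', hg'⟩ := h'
    exact ⟨_, _, hs.alt hs', ht.alt ht', hg.alt hg'⟩
  | seq _ _ h h' =>
    obtain ⟨s, t, hs, ht, hg⟩ := h
    obtain ⟨s', t', hs', ht', hg'⟩ := h'
    exact ⟨_, _, hs.seq hs'.bb, ht.seq ht'.bb, hg.seq hg'⟩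
  | delay _ h =>
    obtain ⟨s, t, hs, ht, hg⟩ := h
    exact ⟨_, _, hs.delay, ht.delay, .delay hg.ctx⟩
  | par _ _ h h' =>
    obtain ⟨s, t, hs, ht, hg⟩ := h
    obtain ⟨s', t', hs', ht', hg'⟩ := h'
    exact ⟨_, _, hs.par hγ hs', ht.par hγ ht', hg.par hg'⟩
  | lmerge _ _ h h' =>
    obtain ⟨s, t, hs, ht, hg⟩ := h
    obtain ⟨s', t', hs', ht', hg'⟩ := h'
    exact ⟨_, _, hs.lmerge hγ hs', ht.lmerge hγ ht', hg.lmerge hg'⟩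
  | cmerge _ _ h h' =>
    obtain ⟨s, t, hs, ht, hg⟩ := h
    obtain ⟨s', t', hs', ht', hg'⟩ := h'
    exact ⟨_, _, hs.cmerge hγ hs', ht.cmerge hγ ht', hg.cmerge hg'⟩
  | encap _ h =>
    obtain ⟨s, t, hs, ht, hg⟩ := h
    exact ⟨_, _, hs.encap _, ht.encap _, hg.encap⟩
  | timeout _ h =>
    obtain ⟨s, t, hs, ht, hg⟩ := h
    exact ⟨_, _, hs.timeout, ht.timeout, hg.timeout⟩

theorem optionRel_symm {Q : Term A → Term A → Prop} (hQ : ∀ s t, Q s t → Q t s)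
    {p q : Option (Term A)} (h : Option.Rel Q p q) : Option.Rel Q q p := by
  cases h with
  | none => exact .none
  | some h => exact .some (hQ _ _ h)

open Relation in
/-- Contexts of related terms are branching bisimilar. -/
theorem Ctx.bb (hγ : CommTau γ) (hs : ∀ s t, P s t → P t s)
    (hP : ∀ s t, P s t → ∃ s' t', RB γ s s' ∧ RB γ t t' ∧ GCtx P s' t')
    {p q : Option (Term A)} (h : Option.Rel (Ctx P) p q) : BB γ p q := by
  set G : Option (Term A) → Option (Term A) → Prop := Option.Rel (GCtx P)
  set C : Option (Term A) → Option (Term A) → Prop := Option.Rel (Ctx P)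
  have hGC : ∀ p q, G p q → C p q := by
    rintro _ _ (h | -)
    exacts [.some h.ctx, .none]
  have hG : ∀ p q, G p q → ∀ α p', Trans (Tr γ) p α p' →
      ∃ q', Trans (Tr γ) q α q' ∧ C p' q' ∧ (α = .act .tau → G p' q') := by
    rintro _ _ (h | -) α p' hp
    exacts [h.tr hγ hp, hp.elim]
  have h₂ : TransferTo (Tr γ) G C := by
    refine fun p q h => ⟨fun α p' hp => ?_, ?_⟩
    · obtain ⟨q', hq, hc, -⟩ := hG p q h α p' hp
      exact .inr ⟨q, q', .refl, hq, hc⟩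
    · rintro rfl
      cases h
      exact .refl
  have hm : MatchesSilent (Tr γ) G := by
    intro p q p' h hp
    obtain ⟨q', hq, -, hg⟩ := hG p q h _ p' hp
    exact .inr ⟨q, q', .refl, hq, hg rfl⟩
  have key : TransferTo (Tr γ) (Comp (Comp (BB γ) G) (BB γ)) (Comp (Comp (BB γ) C) (BB γ)) :=
    TransferTo.comp (TransferTo.comp BB.transfer h₂ hm hGC) BB.transfer
      BB.transfer.matchesSilent fun _ _ => id
  -- Every context of related terms expands, up to `BB`, to a guarded one. This restores the guards
  -- lost by visible and σ-steps and closes the transfer condition `key` on a single relation.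
  have e : Comp (Comp (BB γ) C) (BB γ) = Comp (Comp (BB γ) G) (BB γ) := by
    funext p q
    refine propext ⟨?_, ?_⟩
    · rintro ⟨q', ⟨p', h₁, h | -⟩, h₂⟩
      · obtain ⟨s, t, hs, ht, hg⟩ := h.exists_gctx hγ hP
        exact ⟨_, ⟨_, h₁.trans hs.bb, .some hg⟩, ht.bb.symm.trans h₂⟩
      · exact ⟨_, ⟨_, h₁, .none⟩, h₂⟩
    · rintro ⟨q', ⟨p', h₁, h⟩, h₂⟩
      exact ⟨q', ⟨p', h₁, hGC _ _ h⟩, h₂⟩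
  refine ⟨Comp (Comp (BB γ) C) (BB γ), ?_, ?_, q, ⟨p, .refl p, h⟩, .refl q⟩
  · rintro p q ⟨q', ⟨p', h₁, h⟩, h₂⟩
    exact ⟨p', ⟨q', h₂.symm, optionRel_symm (fun _ _ => Ctx.symm hs) h⟩, h₁.symm⟩
  · rw [← e] at key
    exact key

/-- Related terms that can be rewritten to guarded contexts of related terms are rooted branching
bisimilar. -/
theorem RB.of_gctx (hγ : CommTau γ) (hs : ∀ s t, P s t → P t s)
    (hP : ∀ s t, P s t → ∃ s' t', RB γ s s' ∧ RB γ t t' ∧ GCtx P s' t')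
    {s t : Term A} (h : P s t) : RB γ s t := by
  refine RB.coind (Q := fun s t => ∃ s' t', RB γ s s' ∧ RB γ t t' ∧ Ctx P s' t') ?_ ?_
    ⟨s, t, .refl s, .refl t, .base h⟩
  · rintro s t ⟨s', t', h₁, h₂, h⟩
    exact ⟨t', s', h₂, h₁, h.symm hs⟩
  · rintro s t ⟨s₁, t₁, hs₁, ht₁, h⟩
    obtain ⟨s₂, t₂, hs₂, ht₂, hg⟩ := h.exists_gctx hγ hP
    have h₁ := (hs₁.trans hs₂).rootMatch
    have h₂ := (ht₁.trans ht₂).symm.rootMatch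
    refine ⟨fun n => h₂.idle (hg.idle (h₁.idle n)), fun a s' k => ?_, fun s' k => ?_⟩
    · obtain ⟨u, hu, hb⟩ := h₁.act _ _ k
      obtain ⟨v, hv, hc, -⟩ := hg.tr hγ hu
      obtain ⟨t', ht, hb'⟩ := h₂.act _ _ hv
      -- After an action only `BB` is owed, so the residual contexts are handled by `Ctx.bb`; after
      -- idling the coinduction continues with the same relation.
      exact ⟨t', ht, hb.trans ((Ctx.bb hγ hs hP hc).trans hb')⟩
    · obtain ⟨u, hu, hb⟩ := h₁.sigma _ k
      obtain ⟨_, hv, ⟨hc⟩, -⟩ := hg.tr hγ hu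
      obtain ⟨t', ht, hb'⟩ := h₂.sigma _ hv
      exact ⟨t', ht, .inr ⟨_, _, hb, hb'.symm, hc⟩⟩

/-! ### Substitution -/

theorem Term.subst_congr {θ θ' : ℕ → Term A} {t : Term A} (h : ∀ X ∈ t.vars, θ X = θ' X) :
    t.subst θ = t.subst θ' := by
  induction t <;> simp_all [Term.vars, Term.subst]

theorem Term.subst_var (t : Term A) : t.subst .var = t := by
  induction t <;> simp_all [Term.subst]

theorem Term.subst_closed {t : Term A} (h : t.vars = ∅) (θ : ℕ → Term A) : t.subst θ = t := by
  rw [Term.subst_congr (θ' := .var) (by simp [h]), Term.subst_var]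

theorem Term.vars_subst {θ : ℕ → Term A} {t : Term A} (h : ∀ X ∈ t.vars, (θ X).vars = ∅) :
    (t.subst θ).vars = ∅ := by
  induction t <;> simp_all [Term.vars, Term.subst]

theorem Term.over_subst {C : (V : Set ℕ) → (V → Term A) → Prop} {θ : ℕ → Term A} {t : Term A}
    (h : t.Over C) (hθ : ∀ X ∈ t.vars, (θ X).Over C) : (t.subst θ).Over C := by
  induction t <;> simp_all [Term.vars, Term.subst, Term.Over]

theorem Term.Over.mono {C C' : (V : Set ℕ) → (V → Term A) → Prop} {t : Term A}
    (h : t.Over C) (hC : ∀ V E, C V E → C' V E) : t.Over C' := by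
  induction t <;> simp_all [Term.Over]

open Classical in
/-- The substitution of `⟨X | E⟩` for the variables `X` of `E`, and of `θ` for the others. -/
noncomputable def fixSubst (V : Set ℕ) (E : V → Term A) (θ : ℕ → Term A) (X : ℕ) : Term A :=
  if h : X ∈ V then .fix V E ⟨X, h⟩ else θ X

@[simp] theorem fixSubst_mem (V : Set ℕ) (E : V → Term A) (θ) (X : V) :
    fixSubst V E θ X = .fix V E X := by simp [fixSubst]

theorem subst_fixSubst {V : Set ℕ} {E : V → Term A} {t : Term A} (h : t.vars ⊆ V) (θ) :
    t.subst (fixSubst V E θ) = Term.close V E t :=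
  Term.subst_congr fun X hX => by simp [fixSubst, h hX]

theorem vars_close {V : Set ℕ} {E : V → Term A} {t : Term A} (h : t.vars ⊆ V) :
    (Term.close V E t).vars = ∅ :=
  Term.vars_subst fun X hX => by simp [h hX, Term.vars]

theorem over_close {C : (V : Set ℕ) → (V → Term A) → Prop} {V : Set ℕ} {E : V → Term A}
    {t : Term A} (h : t.vars ⊆ V) (ht : t.Over C) (hE : C V E) : (Term.close V E t).Over C :=
  Term.over_subst ht fun X hX => by simpa [h hX, Term.Over] using hE

theorem Ax.subst {s t : Term A} (h : Ax γ s t) (θ : ℕ → Term A) :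
    Ax γ (s.subst θ) (t.subst θ) := by
  cases h <;> simp only [Term.subst] <;> constructor <;> assumption

/-! ### Specifications -/

theorem SpecLevel.vars_subset {i : ℕ} {V : Set ℕ} {E : V → Term A} (h : SpecLevel γ i V E)
    (X : V) : (E X).vars ⊆ V := by
  induction i with
  | zero => exact h.elim
  | succ i ih => exact h.elim ih fun h => (h X).2.1

theorem SpecLevel.over {i : ℕ} {V : Set ℕ} {E : V → Term A} (h : SpecLevel γ i V E)
    (X : V) : (E X).Over (SpecLevel γ i) := by
  induction i with
  | zero => exact h.elim
  | succ i ih => exact (h.elim ih fun h => (h X).1).mono fun _ _ => .inl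

theorem SpecLevel.exists_guardedSpec {i : ℕ} {V : Set ℕ} {E : V → Term A}
    (h : SpecLevel γ i V E) : ∃ j, GuardedSpec γ (SpecLevel γ j) V E := by
  induction i with
  | zero => exact h.elim
  | succ i ih => exact h.elim ih fun h => ⟨i, h⟩

/-- Any solution `p` up to `RB` makes the unfolding steps sound, and `RB` is a congruence, so
rewriting may take place anywhere. It serves twice: for uniqueness of solutions and for the
evaluation of recursion constants. -/
theorem Rewr.rb (hγ : CommTau γ) {i : ℕ} {V : Set ℕ} {E : V → Term A} {X : V} {s t : Term A}
    {p : ℕ → Term A} (hp : ∀ Y : V, RB γ (p Y) ((E Y).subst p))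
    (h : Rewr γ (SpecLevel γ i) V E X s t) : RB γ (s.subst p) (t.subst p) := by
  have eqn : ∀ {s t : Term A}, Eqn γ (SpecLevel γ i) s t → RB γ (s.subst p) (t.subst p) := by
    rintro s t (⟨h, -, -⟩ | ⟨V, E, X, h⟩)
    · exact (h.subst p).rb hγ
    -- An unfolded recursion constant is closed, so the substitution for the outer variables does
    -- not touch it.
    · rw [Term.subst_closed (vars_close (h.vars_subset X))]
      exact RB.fix V E X
  induction h with
  | left_right h => exact eqn h
  | right_left h => exact (eqn h).symm
  | unfold Y _ => exact hp Y
  | refl s => exact .refl _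
  | trans _ _ h h' => exact h.trans h'
  | alt _ _ h h' => exact h.alt h'
  | seq _ _ h h' => exact h.seq h'.bb
  | delay _ h => exact h.delay
  | par _ _ h h' => exact h.par hγ h'
  | lmerge _ _ h h' => exact h.lmerge hγ h'
  | cmerge _ _ h h' => exact h.cmerge hγ h'
  | encap H _ h => exact h.encap H
  | abstr I _ h => exact h.abstr I
  | timeout _ h => exact h.timeout

theorem Rewr.over {i : ℕ} {V : Set ℕ} {E : V → Term A} {X : V} {s t : Term A}
    (hE : ∀ Y, (E Y).Over (SpecLevel γ i)) (h : Rewr γ (SpecLevel γ i) V E X s t) :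
    s.Over (SpecLevel γ i) → t.Over (SpecLevel γ i) := by
  have eqn : ∀ {s t : Term A}, Eqn γ (SpecLevel γ i) s t →
      s.Over (SpecLevel γ i) ∧ t.Over (SpecLevel γ i) := by
    rintro s t (⟨-, h, h'⟩ | ⟨V, E, X, h⟩)
    · exact ⟨h, h'⟩
    · exact ⟨h, over_close (h.vars_subset X) (h.over X) h⟩
  induction h with
  | left_right h => exact fun _ => (eqn h).2
  | right_left h => exact fun _ => (eqn h).1
  | unfold Y _ => exact fun _ => hE Y
  | refl s => exact id
  | trans _ _ h h' => exact h' ∘ h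
  | alt _ _ h h' | seq _ _ h h' | par _ _ h h' | lmerge _ _ h h' | cmerge _ _ h h' =>
    exact And.imp h h'
  | delay _ h | encap _ _ h | abstr _ _ h | timeout _ h => exact h

theorem ctx_subst {P : Term A → Term A → Prop} {p q : ℕ → Term A}
    (h : ∀ X, Ctx P (p X) (q X)) {t : Term A} (ht : t.NoAbstr) :
    Ctx P (t.subst p) (t.subst q) := by
  induction t with
  | var X => exact h X
  | cts a => exact .refl _
  | alt s t hs ht' => exact .alt (hs ht.1) (ht' ht.2)
  | seq s t hs ht' => exact .seq (hs ht.1) (ht' ht.2)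
  | delay t ih => exact .delay (ih ht)
  | par s t hs ht' => exact .par (hs ht.1) (ht' ht.2)
  | lmerge s t hs ht' => exact .lmerge (hs ht.1) (ht' ht.2)
  | cmerge s t hs ht' => exact .cmerge (hs ht.1) (ht' ht.2)
  | encap H t ih => exact .encap (ih ht)
  | abstr I t ih => exact ht.elim
  | timeout t ih => exact .timeout (ih ht)
  | fix V E X => exact .refl _

theorem gctx_subst {P : Term A → Term A → Prop} {p q : ℕ → Term A}
    (h : ∀ X, Ctx P (p X) (q X)) {t : Term A} (ht : t.Guarded) :
    GCtx P (t.subst p) (t.subst q) := by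
  rcases ht with ht | ⟨hn, hp⟩
  -- A guarded term without variables may contain abstraction, but then both substitution instances
  -- are the same term.
  · rw [Term.subst_closed ht, Term.subst_closed ht]
    exact .refl t
  induction t with
  | var X => exact hp.elim
  | cts a => exact .refl _
  | alt s t hs ht' => exact .alt (hs hn.1 hp.1) (ht' hn.2 hp.2)
  | seq s t hs ht' =>
    rcases hp with ⟨a, rfl⟩ | hp
    · exact .pre a (ctx_subst h hn.2)
    · exact .seq (hs hn.1 hp.1) (ht' hn.2 hp.2)
  | delay t ih => exact .delay (ctx_subst h hn)
  | par s t hs ht' => exact .par (hs hn.1 hp.1) (ht' hn.2 hp.2)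
  | lmerge s t hs ht' => exact .lmerge (hs hn.1 hp.1) (ht' hn.2 hp.2)
  | cmerge s t hs ht' => exact .cmerge (hs hn.1 hp.1) (ht' hn.2 hp.2)
  | encap H t ih => exact .encap (ih hn hp)
  | abstr I t ih => exact hn.elim
  | timeout t ih => exact .timeout (ih hn hp)
  | fix V E X => exact .refl _

/-- Solutions of guarded specifications are unique up to rooted branching bisimilarity. -/
theorem RB.of_solutions (hγ : CommTau γ) {V : Set ℕ} {E : V → Term A} (hE : IsSpec γ V E)
    {p q : ℕ → Term A} (hp : ∀ Y : V, RB γ (p Y) ((E Y).subst p))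
    (hq : ∀ Y : V, RB γ (q Y) ((E Y).subst q)) (hpq : ∀ Y ∉ V, p Y = q Y) (X : V) :
    RB γ (p X) (q X) := by
  obtain ⟨i, hE⟩ := hE
  obtain ⟨j, hE⟩ := hE.exists_guardedSpec
  let P : Term A → Term A → Prop := fun s t =>
    ∃ Y : V, (s = p Y ∧ t = q Y) ∨ (s = q Y ∧ t = p Y)
  have hs : ∀ s t, P s t → P t s := fun s t ⟨Y, h⟩ => ⟨Y, h.symm.imp And.symm And.symm⟩
  have hP : ∀ Y, Ctx P (p Y) (q Y) := by
    intro Y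
    -- Axioms used from right to left can introduce variables outside `V` into the guarded form, for
    -- instance by expanding a deadlock; there the two substitutions agree.
    by_cases hY : Y ∈ V
    · exact .base ⟨⟨Y, hY⟩, .inl ⟨rfl, rfl⟩⟩
    · rw [hpq Y hY]
      exact .refl _
  refine RB.of_gctx hγ hs ?_ (P := P) ⟨X, .inl ⟨rfl, rfl⟩⟩
  rintro s t ⟨Y, h⟩
  obtain ⟨-, -, g, hg, hgg⟩ := hE Y
  have h₁ := (hp Y).trans (hg.rb hγ hp)
  have h₂ := (hq Y).trans (hg.rb hγ hq)
  rcases h with ⟨rfl, rfl⟩ | ⟨rfl, rfl⟩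
  · exact ⟨_, _, h₁, h₂, gctx_subst hP hgg⟩
  · exact ⟨_, _, h₂, h₁, gctx_subst (fun Y => (hP Y).symm hs) hgg⟩

theorem SpecLevel.fixSubst_solution {i : ℕ} {V : Set ℕ} {E : V → Term A}
    (h : SpecLevel γ i V E) (θ : ℕ → Term A) (Y : V) :
    RB γ (fixSubst V E θ Y) ((E Y).subst (fixSubst V E θ)) := by
  rw [fixSubst_mem, subst_fixSubst (h.vars_subset Y)]
  exact RB.fix V E Y

theorem Deriv.rb (hγ : CommTau γ) {s t : Term A} (h : Deriv γ s t) : RB γ s t := by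
  induction h with
  | ax h _ _ => exact h.rb hγ
  | rdp V E X _ => exact RB.fix V E X
  | rsp V E X θ hE _ ih =>
    -- The constants form a second solution, extended by `θ` outside `V` so that it agrees with the
    -- given one there.
    have hq := fun Y => hE.choose_spec.fixSubst_solution θ Y
    simpa using RB.of_solutions hγ hE ih hq (fun Y hY => by simp [fixSubst, hY]) X
  | refl s _ => exact .refl _
  | symm _ h => exact h.symm
  | trans _ _ h h' => exact h.trans h'
  | alt _ _ h h' => exact h.alt h'
  | seq _ _ h h' => exact h.seq h'.bb
  | delay _ h => exact h.delay
  | par _ _ h h' => exact h.par hγ h'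
  | lmerge _ _ h h' => exact h.lmerge hγ h'
  | cmerge _ _ h h' => exact h.cmerge hγ h'
  | encap H _ h => exact h.encap H
  | abstr I _ h => exact h.abstr I
  | timeout _ h => exact h.timeout

/-! ### Idling of process terms is decided -/

theorem IdleVal.exists_alt {x y : Term A} (h : ∃ b, IdleVal x b) (h' : ∃ b, IdleVal y b) :
    ∃ b, IdleVal (x ⊹ y) b :=
  ⟨_, .alt h.choose_spec h'.choose_spec⟩

theorem IdleVal.exists_par {x y : Term A} (h : ∃ b, IdleVal x b) (h' : ∃ b, IdleVal y b) :
    ∃ b, IdleVal (x ∥ y) b := by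
  obtain ⟨_ | _, h⟩ := h <;> obtain ⟨_ | _, h'⟩ := h'
  exacts [⟨_, .par_left h⟩, ⟨_, .par_left h⟩, ⟨_, .par_right h'⟩, ⟨_, .par h h'⟩]

theorem IdleVal.exists_lmerge {x y : Term A} (h : ∃ b, IdleVal x b) (h' : ∃ b, IdleVal y b) :
    ∃ b, IdleVal (x ⫦ y) b := by
  obtain ⟨_ | _, h⟩ := h <;> obtain ⟨_ | _, h'⟩ := h'
  exacts [⟨_, .lmerge_left h⟩, ⟨_, .lmerge_left h⟩, ⟨_, .lmerge_right h'⟩, ⟨_, .lmerge h h'⟩]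

theorem IdleVal.exists_cmerge {x y : Term A} (h : ∃ b, IdleVal x b) (h' : ∃ b, IdleVal y b) :
    ∃ b, IdleVal (x ⦀ y) b := by
  obtain ⟨_ | _, h⟩ := h <;> obtain ⟨_ | _, h'⟩ := h'
  exacts [⟨_, .cmerge_left h⟩, ⟨_, .cmerge_left h⟩, ⟨_, .cmerge_right h'⟩, ⟨_, .cmerge h h'⟩]

/-- Evaluation never enters what lies behind an action prefix or a delay, so the terms substituted
at guarded variables need not have a value. -/
theorem exists_idleVal_subst {C : (V : Set ℕ) → (V → Term A) → Prop}
    (hC : ∀ V E X, C V E → ∃ b, IdleVal (.fix V E X) b) {t : Term A} (hO : t.Over C)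
    (ht : t.vars = ∅ ∨ t.AllPrefixed) (θ : ℕ → Term A) : ∃ b, IdleVal (t.subst θ) b := by
  have split : ∀ {s t : Term A}, s.vars ∪ t.vars = ∅ ∨ s.AllPrefixed ∧ t.AllPrefixed →
      (s.vars = ∅ ∨ s.AllPrefixed) ∧ (t.vars = ∅ ∨ t.AllPrefixed) := by
    intro s t h
    rw [Set.union_empty_iff] at h
    tauto
  induction t with
  | var X => simp [Term.vars, Term.AllPrefixed] at ht
  | cts a => exact ⟨_, .cts a⟩
  | alt s t hs ht' =>
    exact IdleVal.exists_alt (hs hO.1 (split ht).1) (ht' hO.2 (split ht).2)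
  | seq s t hs ht' =>
    rcases ht with ht | ⟨a, rfl⟩ | ht
    · exact (hs hO.1 (split (.inl ht)).1).imp fun _ => .seq
    · exact ⟨_, .seq (.cts _)⟩
    · exact (hs hO.1 (.inr ht.1)).imp fun _ => .seq
  | delay t ih => exact ⟨_, .delay _⟩
  | par s t hs ht' =>
    exact IdleVal.exists_par (hs hO.1 (split ht).1) (ht' hO.2 (split ht).2)
  | lmerge s t hs ht' =>
    exact IdleVal.exists_lmerge (hs hO.1 (split ht).1) (ht' hO.2 (split ht).2)
  | cmerge s t hs ht' =>
    exact IdleVal.exists_cmerge (hs hO.1 (split ht).1) (ht' hO.2 (split ht).2)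
  | encap H t ih => exact (ih hO ht).imp fun _ => .encap
  | abstr I t ih => exact (ih hO ht).imp fun _ => .abstr
  | timeout t ih => exact ⟨_, .timeout _⟩
  | fix V E X => exact hC V E X hO

/-- A right-hand side need not be guarded itself, so it cannot be evaluated directly. Its guarded
rewriting contains only constants of the preceding level and hence has a value by induction;
rewriting is sound for `RB`, and `RB` transports values back. No totality was assumed for that
soundness, so the argument is not circular. -/
theorem SpecLevel.exists_idleVal (hγ : CommTau γ) {i : ℕ} :
    ∀ (V : Set ℕ) (E : V → Term A) (X : V), SpecLevel γ i V E →
      ∃ b, IdleVal (.fix V E X) b := by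
  induction i with
  | zero => exact fun _ _ _ => False.elim
  | succ i ih =>
    intro V E X hE
    rcases id hE with h | h
    · exact ih V E X h
    · obtain ⟨hO, hv, g, hg, hgg⟩ := h X
      obtain ⟨b, hb⟩ := exists_idleVal_subst ih (hg.over (fun Y => (h Y).1) hO)
        (hgg.imp_right And.right) (fixSubst V E .var)
      have h' := (hg.rb hγ (hE.fixSubst_solution .var)).idleVal_iff b
      rw [subst_fixSubst hv] at h'
      exact ⟨b, .fix (h'.2 hb)⟩

theorem IsProc.exists_idleVal (hγ : CommTau γ) {t : Term A} (h : IsProc γ t) :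
    ∃ b, IdleVal t b := by
  have := exists_idleVal_subst (C := IsSpec γ)
    (fun V E X ⟨i, h⟩ => SpecLevel.exists_idleVal hγ (i := i) V E X h) h.2 (.inl h.1) .var
  rwa [Term.subst_var] at this

/-! ### Process terms -/

@[simp] theorem isProc_alt (x y : Term A) : IsProc γ (x ⊹ y) ↔ IsProc γ x ∧ IsProc γ y := by
  simp [IsProc, InSignature, Term.vars, Term.Over]; tauto

@[simp] theorem isProc_seq (x y : Term A) : IsProc γ (x ⊙ y) ↔ IsProc γ x ∧ IsProc γ y := by
  simp [IsProc, InSignature, Term.vars, Term.Over]; tauto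

@[simp] theorem isProc_par (x y : Term A) : IsProc γ (x ∥ y) ↔ IsProc γ x ∧ IsProc γ y := by
  simp [IsProc, InSignature, Term.vars, Term.Over]; tauto

@[simp] theorem isProc_lmerge (x y : Term A) :
    IsProc γ (x ⫦ y) ↔ IsProc γ x ∧ IsProc γ y := by
  simp [IsProc, InSignature, Term.vars, Term.Over]; tauto

@[simp] theorem isProc_cmerge (x y : Term A) :
    IsProc γ (x ⦀ y) ↔ IsProc γ x ∧ IsProc γ y := by
  simp [IsProc, InSignature, Term.vars, Term.Over]; tauto

@[simp] theorem isProc_delay (x : Term A) : IsProc γ (.delay x) ↔ IsProc γ x := Iff.rfl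

@[simp] theorem isProc_timeout (x : Term A) : IsProc γ (.timeout x) ↔ IsProc γ x := Iff.rfl

@[simp] theorem isProc_encap (H) (x : Term A) : IsProc γ (.encap H x) ↔ IsProc γ x := Iff.rfl

@[simp] theorem isProc_abstr (I) (x : Term A) : IsProc γ (.abstr I x) ↔ IsProc γ x := Iff.rfl

theorem IsProc.close {V : Set ℕ} {E : V → Term A} {X : V} (h : IsProc γ (.fix V E X)) :
    IsProc γ (Term.close V E (E X)) := by
  obtain ⟨i, hi⟩ : IsSpec γ V E := h.2
  exact ⟨vars_close (hi.vars_subset X),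
    over_close (hi.vars_subset X) ((hi.over X).mono fun _ _ h => ⟨i, h⟩) ⟨i, hi⟩⟩

theorem Step.isProc {N : Term A → Prop} {t : Term A} {α s} (h : Step γ N t α s)
    (ht : IsProc γ t) : ∀ u ∈ s, IsProc γ u := by
  induction h with
  | fix _ ih => exact ih ht.close
  | _ => simp_all

/-- Negative assumptions occur positively in the rules, and a deduction starting from a process
consults them only about processes. -/
theorem Step.mono {N N' : Term A → Prop} (hN : ∀ y, IsProc γ y → N y → N' y) {t : Term A}
    {α s} (h : Step γ N t α s) (ht : IsProc γ t) : Step γ N' t α s := by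
  induction h with
  | cts a => exact .cts a
  | delay x => exact .delay x
  | fix _ ih => exact .fix (ih ht.close)
  | alt_left _ ih => exact .alt_left (ih ((isProc_alt ..).1 ht).1)
  | alt_right _ ih => exact .alt_right (ih ((isProc_alt ..).1 ht).2)
  | alt_idle_left _ h ih =>
    exact .alt_idle_left (ih ((isProc_alt ..).1 ht).1) (hN _ ((isProc_alt ..).1 ht).2 h)
  | alt_idle_right h _ ih =>
    exact .alt_idle_right (hN _ ((isProc_alt ..).1 ht).1 h) (ih ((isProc_alt ..).1 ht).2)
  | alt_idle _ _ ih ih' =>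
    exact .alt_idle (ih ((isProc_alt ..).1 ht).1) (ih' ((isProc_alt ..).1 ht).2)
  | seq _ ih => exact .seq (ih ((isProc_seq ..).1 ht).1)
  | seq_term _ ih => exact .seq_term (ih ((isProc_seq ..).1 ht).1)
  | seq_idle _ ih => exact .seq_idle (ih ((isProc_seq ..).1 ht).1)
  | par_left _ ih => exact .par_left (ih ((isProc_par ..).1 ht).1)
  | par_right _ ih => exact .par_right (ih ((isProc_par ..).1 ht).2)
  | par_left_term _ ih => exact .par_left_term (ih ((isProc_par ..).1 ht).1)
  | par_right_term _ ih => exact .par_right_term (ih ((isProc_par ..).1 ht).2)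
  | par_comm _ _ e ih ih' =>
    exact .par_comm (ih ((isProc_par ..).1 ht).1) (ih' ((isProc_par ..).1 ht).2) e
  | par_comm_right_term _ _ e ih ih' =>
    exact .par_comm_right_term (ih ((isProc_par ..).1 ht).1) (ih' ((isProc_par ..).1 ht).2) e
  | par_comm_left_term _ _ e ih ih' =>
    exact .par_comm_left_term (ih ((isProc_par ..).1 ht).1) (ih' ((isProc_par ..).1 ht).2) e
  | par_comm_term _ _ e ih ih' =>
    exact .par_comm_term (ih ((isProc_par ..).1 ht).1) (ih' ((isProc_par ..).1 ht).2) e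
  | par_idle _ _ ih ih' =>
    exact .par_idle (ih ((isProc_par ..).1 ht).1) (ih' ((isProc_par ..).1 ht).2)
  | lmerge _ ih => exact .lmerge (ih ((isProc_lmerge ..).1 ht).1)
  | lmerge_term _ ih => exact .lmerge_term (ih ((isProc_lmerge ..).1 ht).1)
  | lmerge_idle _ _ ih ih' =>
    exact .lmerge_idle (ih ((isProc_lmerge ..).1 ht).1) (ih' ((isProc_lmerge ..).1 ht).2)
  | cmerge _ _ e ih ih' =>
    exact .cmerge (ih ((isProc_cmerge ..).1 ht).1) (ih' ((isProc_cmerge ..).1 ht).2) e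
  | cmerge_right_term _ _ e ih ih' =>
    exact .cmerge_right_term (ih ((isProc_cmerge ..).1 ht).1) (ih' ((isProc_cmerge ..).1 ht).2) e
  | cmerge_left_term _ _ e ih ih' =>
    exact .cmerge_left_term (ih ((isProc_cmerge ..).1 ht).1) (ih' ((isProc_cmerge ..).1 ht).2) e
  | cmerge_term _ _ e ih ih' =>
    exact .cmerge_term (ih ((isProc_cmerge ..).1 ht).1) (ih' ((isProc_cmerge ..).1 ht).2) e
  | cmerge_idle _ _ ih ih' =>
    exact .cmerge_idle (ih ((isProc_cmerge ..).1 ht).1) (ih' ((isProc_cmerge ..).1 ht).2)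
  | encap _ h ih => exact .encap (ih ht) h
  | encap_term _ h ih => exact .encap_term (ih ht) h
  | encap_idle _ ih => exact .encap_idle (ih ht)
  | abstr _ h ih => exact .abstr (ih ht) h
  | abstr_term _ h ih => exact .abstr_term (ih ht) h
  | abstr_hide _ h ih => exact .abstr_hide (ih ht) h
  | abstr_hide_term _ h ih => exact .abstr_hide_term (ih ht) h
  | abstr_idle _ ih => exact .abstr_idle (ih ht)
  | timeout _ ih => exact .timeout (ih ht)

/-- Decided idling agrees with the transition rules whenever the negative assumptions include those
about process terms that hold. -/
theorem IdleVal.step {N : Term A → Prop}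
    (hN : ∀ y, IsProc γ y → (∀ y', ¬ Step γ N y .sigma (some y')) → N y)
    {t : Term A} {b} (h : IdleVal t b) (ht : IsProc γ t) :
    (b = true → ∃ s, Step γ N t .sigma (some s)) ∧
      (b = false → ∀ s, ¬ Step γ N t .sigma (some s)) := by
  induction h with
  | cts a => exact ⟨nofun, fun _ _ h => by cases h⟩
  | delay x => exact ⟨fun _ => ⟨x, .delay x⟩, nofun⟩
  | timeout x => exact ⟨nofun, fun _ _ h => by cases h⟩
  | @alt x y b c _ _ ih ih' =>
    obtain ⟨hx, hy⟩ := (isProc_alt ..).1 ht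
    have ihx := ih hx
    have ihy := ih' hy
    refine ⟨fun e => ?_, fun e s h => ?_⟩
    · cases b <;> cases c
      · cases e
      · obtain ⟨s, hs⟩ := ihy.1 rfl
        exact ⟨s, .alt_idle_right (hN x hx (ihx.2 rfl)) hs⟩
      · obtain ⟨s, hs⟩ := ihx.1 rfl
        exact ⟨s, .alt_idle_left hs (hN y hy (ihy.2 rfl))⟩
      · obtain ⟨s, hs⟩ := ihx.1 rfl
        obtain ⟨s', hs'⟩ := ihy.1 rfl
        exact ⟨_, .alt_idle hs hs'⟩
    · obtain ⟨rfl, rfl⟩ := Bool.or_eq_false_iff.1 e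
      cases h with
      | alt_idle_left h _ => exact ihx.2 rfl _ h
      | alt_idle_right _ h => exact ihy.2 rfl _ h
      | alt_idle h _ => exact ihx.2 rfl _ h
  | seq _ ih =>
    have ih := ih ((isProc_seq ..).1 ht).1
    refine ⟨fun e => ⟨_, .seq_idle (ih.1 e).choose_spec⟩, fun e s h => ?_⟩
    cases h with | seq_idle h => exact ih.2 e _ h
  | par _ _ ih ih' =>
    obtain ⟨hx, hy⟩ := (isProc_par ..).1 ht
    exact ⟨fun _ => ⟨_, .par_idle ((ih hx).1 rfl).choose_spec ((ih' hy).1 rfl).choose_spec⟩, nofun⟩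
  | par_left _ ih =>
    refine ⟨nofun, fun e s h => ?_⟩
    cases h with | par_idle h _ => exact (ih ((isProc_par ..).1 ht).1).2 rfl _ h
  | par_right _ ih =>
    refine ⟨nofun, fun e s h => ?_⟩
    cases h with | par_idle _ h => exact (ih ((isProc_par ..).1 ht).2).2 rfl _ h
  | lmerge _ _ ih ih' =>
    obtain ⟨hx, hy⟩ := (isProc_lmerge ..).1 ht
    exact ⟨fun _ => ⟨_, .lmerge_idle ((ih hx).1 rfl).choose_spec ((ih' hy).1 rfl).choose_spec⟩, nofun⟩
  | lmerge_left _ ih =>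
    refine ⟨nofun, fun e s h => ?_⟩
    cases h with | lmerge_idle h _ => exact (ih ((isProc_lmerge ..).1 ht).1).2 rfl _ h
  | lmerge_right _ ih =>
    refine ⟨nofun, fun e s h => ?_⟩
    cases h with | lmerge_idle _ h => exact (ih ((isProc_lmerge ..).1 ht).2).2 rfl _ h
  | cmerge _ _ ih ih' =>
    obtain ⟨hx, hy⟩ := (isProc_cmerge ..).1 ht
    exact ⟨fun _ => ⟨_, .cmerge_idle ((ih hx).1 rfl).choose_spec ((ih' hy).1 rfl).choose_spec⟩, nofun⟩
  | cmerge_left _ ih =>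
    refine ⟨nofun, fun e s h => ?_⟩
    cases h with | cmerge_idle h _ => exact (ih ((isProc_cmerge ..).1 ht).1).2 rfl _ h
  | cmerge_right _ ih =>
    refine ⟨nofun, fun e s h => ?_⟩
    cases h with | cmerge_idle _ h => exact (ih ((isProc_cmerge ..).1 ht).2).2 rfl _ h
  | encap _ ih =>
    refine ⟨fun e => ⟨_, .encap_idle ((ih ht).1 e).choose_spec⟩, fun e s h => ?_⟩
    cases h with | encap_idle h => exact (ih ht).2 e _ h
  | abstr _ ih =>
    refine ⟨fun e => ⟨_, .abstr_idle ((ih ht).1 e).choose_spec⟩, fun e s h => ?_⟩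
    cases h with | abstr_idle h => exact (ih ht).2 e _ h
  | fix _ ih =>
    refine ⟨fun e => ⟨_, .fix ((ih ht.close).1 e).choose_spec⟩, fun e s h => ?_⟩
    cases h with | fix h => exact (ih ht.close).2 e _ h

/-! ### The operational semantics -/

/-- The transition relation `Tr γ` restricted to process terms. -/
def procTr (γ : Acttd A → Acttd A → Acttd A) (t : Term A) (α : Label A)
    (s : Option (Term A)) : Prop :=
  IsProc γ t ∧ Tr γ t α s

theorem isOpSem_procTr (hγ : CommTau γ) : IsOpSem γ (procTr γ) := by
  refine fun t α s => and_congr_right fun ht => ⟨fun h => h.mono ?_ ht, fun h => h.mono ?_ ht⟩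
  · exact fun y _ hn y' h => hn.not_tr _ h.2
  -- Totality of the evaluation on processes enters here: without a value, a process that cannot
  -- idle might fail to satisfy the negative premise of `Tr`.
  · intro y hy hn
    obtain ⟨_ | _, hb⟩ := hy.exists_idleVal hγ
    · exact hb
    · obtain ⟨y', hy'⟩ := hb.exists_tr (γ := γ) rfl
      exact (hn y' ⟨hy, hy'⟩).elim

theorem IsOpSem.eq_procTr (hγ : CommTau γ) {T : Term A → Label A → Option (Term A) → Prop}
    (hT : IsOpSem γ T) : T = procTr γ := by
  -- On processes, `N` is shown to coincide with the value `false`. It contains every process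
  -- without a deducible σ-transition, which lets `IdleVal.step` compute deducibility under `N`.
  set N : Term A → Prop := fun y => ∀ y', ¬ T y .sigma (some y') with hN
  have hNs : ∀ y, IsProc γ y → (∀ y', ¬ Step γ N y .sigma (some y')) → N y :=
    fun y _ h y' hy' => h y' ((hT _ _ _).1 hy').2
  have hNs' : ∀ y, IsProc γ y → N y → ∀ y', ¬ Step γ N y .sigma (some y') :=
    fun y hy h y' hy' => h y' ((hT _ _ _).2 ⟨hy, hy'⟩)
  funext t α s
  refine propext ((hT t α s).trans (and_congr_right fun ht =>
    ⟨fun h => h.mono ?_ ht, fun h => h.mono ?_ ht⟩))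
  · intro y hy hn
    obtain ⟨_ | _, hb⟩ := hy.exists_idleVal hγ
    · exact hb
    · obtain ⟨y', hy'⟩ := (hb.step hNs hy).1 rfl
      exact (hNs' y hy hn y' hy').elim
  · exact fun y hy hn => hNs y hy ((hn.step hNs hy).2 rfl)

/-! ### Bisimilarity restricted to process terms -/

theorem trans_procTr {p s : Option (Term A)} {α} (hp : ∀ t ∈ p, IsProc γ t) :
    Trans (procTr γ) p α s ↔ Trans (Tr γ) p α s := by
  cases p with
  | none => exact Iff.rfl
  | some t => exact and_iff_right (hp t rfl)

theorem Trans.isProc {p s : Option (Term A)} {α} (h : Trans (Tr γ) p α s)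
    (hp : ∀ t ∈ p, IsProc γ t) : ∀ t ∈ s, IsProc γ t := by
  cases p with
  | none => exact h.elim
  | some t => exact Step.isProc h (hp t rfl)

/-- Branching bisimilarity on process terms and `√`. -/
def ProcBB (γ : Acttd A → Acttd A → Acttd A) (p q : Option (Term A)) : Prop :=
  (∀ t ∈ p, IsProc γ t) ∧ (∀ t ∈ q, IsProc γ t) ∧ BB γ p q

theorem Silent.procTr {p q r : Option (Term A)} (h : Silent (Tr γ) (BB γ) p q r)
    (hp : ∀ t ∈ p, IsProc γ t) (hq : ∀ t ∈ q, IsProc γ t) :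
    Silent (procTr γ) (ProcBB γ) p q r ∧ ∀ t ∈ r, IsProc γ t := by
  induction h with
  | refl => exact ⟨.refl, hq⟩
  | tail _ h ih =>
    have hr := h.1.isProc ih.2
    exact ⟨ih.1.tail ⟨(trans_procTr ih.2).2 h.1, hp, hr, h.2⟩, hr⟩

theorem ProcBB.symm {p q : Option (Term A)} (h : ProcBB γ p q) : ProcBB γ q p :=
  ⟨h.2.1, h.1, h.2.2.symm⟩

theorem ProcBB.transfer : Transfer (procTr γ) (ProcBB γ : Option (Term A) → _) := by
  rintro p q ⟨hp, hq, h⟩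
  refine ⟨fun α p' hpp' => ?_, fun e => (((BB.transfer p q h).2 e).procTr hp hq).1⟩
  rw [trans_procTr hp] at hpp'
  have hp' := hpp'.isProc hp
  rcases (BB.transfer p q h).1 _ _ hpp' with ⟨e, hb⟩ | ⟨r, q', hr, hq', hb⟩
  · exact .inl ⟨e, hp', hq, hb⟩
  · obtain ⟨hr, hrp⟩ := hr.procTr hp hq
    exact .inr ⟨r, q', hr, (trans_procTr hrp).2 hq', hp', hq'.isProc hrp, hb⟩

theorem isBranchingBisim_procBB : IsBranchingBisim γ (procTr γ) (ProcBB γ) where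
  proc _ _ h := ⟨h.1, h.2.1⟩
  forth := ProcBB.transfer
  back := by
    have e : flip (ProcBB γ) = (ProcBB γ : Option (Term A) → _) := by
      funext p q
      exact propext ⟨ProcBB.symm, ProcBB.symm⟩
    rw [e]
    exact ProcBB.transfer

/-- By time determinism, the state reached by idling on the right is the very one that matches the
state on the left. -/
theorem RB.idles {s t s' t' : Term A} {n} (h : RB γ s t) (hs : Idles (procTr γ) n s s')
    (ht : Idles (procTr γ) n t t') : RB γ s' t' := by
  induction n generalizing s t with
  | zero => cases hs; cases ht; exact h
  | succ n ih =>
    obtain ⟨u, hu, hs⟩ := hs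
    obtain ⟨v, hv, ht⟩ := ht
    obtain ⟨v', hv', h'⟩ := h.rootMatch.sigma _ hu.2
    cases hv.2.sigma_unique hv' rfl
    exact ih h' hs ht

theorem RB.exists_procTr {s t : Term A} (h : RB γ s t) (ht : IsProc γ t) {α s'}
    (hs : procTr γ s α s') : ∃ t', procTr γ t α t' ∧ ProcBB γ s' t' := by
  have hsp := Step.isProc hs.2 hs.1
  cases α with
  | act a =>
    obtain ⟨t', ht', hb⟩ := h.rootMatch.act _ _ hs.2
    exact ⟨t', ⟨ht, ht'⟩, hsp, Step.isProc ht' ht, hb⟩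
  | sigma =>
    obtain ⟨s', rfl⟩ := Step.sigma_isSome hs.2 rfl
    obtain ⟨t', ht', hb⟩ := h.rootMatch.sigma _ hs.2
    exact ⟨t', ⟨ht, ht'⟩, hsp, Step.isProc ht' ht, hb.bb⟩

/-- The witness is all of branching bisimilarity on processes. The root condition for delayed
descendants comes from their being in `RB`, not merely from their being related by the witness. -/
theorem RB.rootedBranchingBisim {s t : Term A} (h : RB γ s t) (hs : IsProc γ s)
    (ht : IsProc γ t) : RootedBranchingBisim γ (procTr γ) s t := by
  refine ⟨ProcBB γ, isBranchingBisim_procBB, ⟨by simpa using hs, by simpa using ht, h.bb⟩, ?_⟩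
  intro n s' t' hs' ht' hb
  have h' := h.idles hs' ht'
  refine ⟨fun α u hu => h'.exists_procTr (hb.2.1 t' rfl) hu, fun α u hu => ?_⟩
  obtain ⟨v, hv, hb'⟩ := h'.symm.exists_procTr (hb.1 s' rfl) hu
  exact ⟨v, hv, hb'.symm⟩

end DRT

/-! ### The soundness theorem -/

theorem mainTheorem7 {A : Type*} [Finite A]
    (γ : DRT.Acttd A → DRT.Acttd A → DRT.Acttd A)
    (hcomm : ∀ a b, γ a b = γ b a)
    (hassoc : ∀ a b c, γ (γ a b) c = γ a (γ b c))
    (htau : ∀ a, γ .tau a = .dead)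
    (hdead : ∀ a, γ .dead a = .dead)
    (hbasic : ∀ a b : A, γ (.basic a) (.basic b) ≠ .tau) :
    (∃! T, DRT.IsOpSem γ T) ∧
      ∀ T, DRT.IsOpSem γ T → ∀ t t', DRT.IsProc γ t → DRT.IsProc γ t' →
        DRT.Deriv γ t t' → DRT.RootedBranchingBisim γ T t t' := by
  have hγ : DRT.CommTau γ := ⟨hcomm, htau, hdead, hbasic⟩
  refine ⟨⟨_, DRT.isOpSem_procTr hγ, fun T hT => hT.eq_procTr hγ⟩, ?_⟩
  intro T hT t t' ht ht' h
  rw [hT.eq_procTr hγ]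
  exact (h.rb hγ).rootedBranchingBisim ht ht'
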